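/- There are a deterministic algorithm and a polynomial $p$ such that, for all $n,k\ge 0$ and every family $\mathcal F$ of $2$-element subsets of an $n$-element set, the algorithm, given $n$, $k$ and $\mathcal F$, computes the number of $k$-packings in $\mathcal F$ (sets of $k$ mutually disjoint members of $\mathcal F$) in time at most $p(n,k)\cdot 3^{k}\max\{1,\binom{n}{k}\}$ and, in the same run, in space at most $p(n,k)$. In particular, for $k\le n$ the time is $O^{*}\big(3^{k}\binom{n}{k}\big)$, where $O^{*}$ suppresses a factor polynomial in $n$ and $k$. Here time and space are measured in bits: the algorithm is a fixed program for a random access machine on natural numbers, each step costs time according to the bit lengths of the numbers and addresses it handles, and space is the largest total number of bits of the addresses and contents of the nonzero cells (input included) at any moment; $\mathcal F$ is given as its symmetric $n\times n$ $0/1$ matrix. -/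

import Mathlib

/-! Counting packings, and a random access machine with logarithmic cost. -/

/-- The number of `k`-packings in `F`: sets of `k` mutually disjoint members of `F`. -/
def numPackings {n : ℕ} (F : Finset (Finset (Fin n))) (k : ℕ) : ℕ :=
  ((F.powersetCard k).filter
    (fun P => ∀ A ∈ P, ∀ B ∈ P, A ≠ B → Disjoint A B)).card

namespace RAM

/-- A machine state: registers, which a program can only name explicitly (so that each program
uses a fixed finite number of them), and a random access memory, which is only reached through
addresses held in registers. Both hold natural numbers of arbitrary size, and all but finitely
many cells are `0`. -/
structure State where
  reg : ℕ →₀ ℕ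
  mem : ℕ →₀ ℕ

/-- The bits needed to write down all nonzero cells: for each one its address and its contents. -/
def cellBits (f : ℕ →₀ ℕ) : ℕ := f.sum (fun a v => Nat.size a + Nat.size v)

/-- The space, in bits, occupied by a state. -/
def State.bits (s : State) : ℕ := cellBits s.reg + cellBits s.mem

/-- Arithmetic operations; `sub` is truncated and `div` rounds down (with value `0` if the
divisor is `0`). -/
inductive Op where
  | add
  | sub
  | mul
  | div

def Op.eval : Op → ℕ → ℕ → ℕ
  | .add, x, y => x + y
  | .sub, x, y => x - y
  | .mul, x, y => x * y
  | .div, x, y => x / y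

/-- The bit cost of the schoolbook methods. -/
def Op.cost : Op → ℕ → ℕ → ℕ
  | .add, x, y => 1 + Nat.size x + Nat.size y
  | .sub, x, y => 1 + Nat.size x + Nat.size y
  | .mul, x, y => (1 + Nat.size x) * (1 + Nat.size y)
  | .div, x, y => (1 + Nat.size x) * (1 + Nat.size y)

inductive Instr where
  /-- `reg d := c` -/
  | const (d c : ℕ)
  /-- `reg d := reg a o reg b` -/
  | arith (o : Op) (d a b : ℕ)
  /-- `reg d := mem (reg a)` -/
  | load (d a : ℕ)
  /-- `mem (reg a) := reg b` -/
  | store (a b : ℕ)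

/-- The state after an instruction. -/
noncomputable def Instr.exec : Instr → State → State
  | .const d c, s => { s with reg := s.reg.update d c }
  | .arith o d a b, s => { s with reg := s.reg.update d (o.eval (s.reg a) (s.reg b)) }
  | .load d a, s => { s with reg := s.reg.update d (s.mem (s.reg a)) }
  | .store a b, s => { s with mem := s.mem.update (s.reg a) (s.reg b) }

/-- The time an instruction takes: bit lengths of all numbers and addresses handled count. -/
def Instr.cost : Instr → State → ℕ
  | .const _ c, _ => 1 + Nat.size c
  | .arith o _ a b, s => o.cost (s.reg a) (s.reg b)
  | .load _ a, s => 1 + Nat.size (s.reg a) + Nat.size (s.mem (s.reg a))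
  | .store a b, s => 1 + Nat.size (s.reg a) + Nat.size (s.reg b)

/-- Programs. -/
inductive Prog where
  | skip
  | instr (i : Instr)
  | seq (p q : Prog)
  /-- if `reg r ≠ 0` then `p` else `q` -/
  | ite (r : ℕ) (p q : Prog)
  /-- while `reg r ≠ 0` do `p` -/
  | loop (r : ℕ) (p : Prog)

/-- `Run p s s' t b`: the program `p`, started in state `s`, halts in state `s'` after time `t`,
and `b` is the maximum of the space occupied by the states passed through
(including `s` and `s'`). -/
inductive Run : Prog → State → State → ℕ → ℕ → Prop where
  | skip (s : State) : Run .skip s s 1 s.bits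
  | instr (i : Instr) (s : State) :
      Run (.instr i) s (i.exec s) (i.cost s) (max s.bits (i.exec s).bits)
  | seq {p q : Prog} {s s₁ s₂ : State} {t₁ t₂ b₁ b₂ : ℕ} :
      Run p s s₁ t₁ b₁ → Run q s₁ s₂ t₂ b₂ →
      Run (.seq p q) s s₂ (t₁ + t₂) (max b₁ b₂)
  | ite_true {r : ℕ} {p q : Prog} {s s' : State} {t b : ℕ} :
      s.reg r ≠ 0 → Run p s s' t b →
      Run (.ite r p q) s s' (1 + Nat.size (s.reg r) + t) b
  | ite_false {r : ℕ} {p q : Prog} {s s' : State} {t b : ℕ} :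
      s.reg r = 0 → Run q s s' t b →
      Run (.ite r p q) s s' (1 + Nat.size (s.reg r) + t) b
  | loop_done {r : ℕ} {p : Prog} {s : State} :
      s.reg r = 0 → Run (.loop r p) s s (1 + Nat.size (s.reg r)) s.bits
  | loop_step {r : ℕ} {p : Prog} {s s₁ s₂ : State} {t₁ t₂ b₁ b₂ : ℕ} :
      s.reg r ≠ 0 → Run p s s₁ t₁ b₁ → Run (.loop r p) s₁ s₂ t₂ b₂ →
      Run (.loop r p) s s₂ (1 + Nat.size (s.reg r) + t₁ + t₂) (max b₁ b₂)

/-- The memory holding a family `F` of 2-element subsets of `{0, …, n - 1}` as an `n × n` matrix: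
cell `i * n + j` contains `1` if `{i, j}` is a member of `F`; all other cells contain `0`. -/
noncomputable def pairMatrix {n : ℕ} (F : Finset (Finset (Fin n))) : ℕ →₀ ℕ :=
  Finsupp.onFinset (Finset.range (n * n))
    (fun a => if ∃ i j : Fin n, a = (i : ℕ) * n + (j : ℕ) ∧ ({i, j} : Finset (Fin n)) ∈ F
      then 1 else 0)
    (by
      intro a ha
      have h : ∃ i j : Fin n, a = (i : ℕ) * n + (j : ℕ) ∧ ({i, j} : Finset (Fin n)) ∈ F := by
        by_contra hc
        exact ha (if_neg hc)
      obtain ⟨i, j, rfl, -⟩ := h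
      rw [Finset.mem_range]
      have h1 : ((i : ℕ) + 1) * n ≤ n * n := Nat.mul_le_mul_right n i.isLt
      have h2 := j.isLt
      rw [Nat.add_mul] at h1
      omega)

/-- The initial state on input `n`, `k`, `F`: register `0` holds `n`, register `1` holds `k`, the
memory holds `F`, and every other cell is `0`. -/
noncomputable def input (n k : ℕ) (F : Finset (Finset (Fin n))) : State where
  reg := Finsupp.single 0 n + Finsupp.single 1 k
  mem := pairMatrix F

end RAM

/-!
Direct each pair in the family from its smaller to its larger element. The `k`-packings are then
the sets of `k` arcs with distinct tails, distinct heads, and no vertex being both a head and a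
tail. For a `k`-set `A` of heads, the product over all `j ∉ A` of `1 + z d`, where `d` is the number
of arcs from `j` into `T ⊆ A`, generates the sets of arcs with distinct tails outside `A` and heads
in `T`, and the alternating sum over `T` keeps those in which every element of `A` is a head. The
coefficient of `z ^ k` in the sum over all pairs `T ⊆ A` thus counts the `k`-packings.

There are `2 ^ k * n.choose k` such pairs. To use little space the machine produces them one at a
time from their ranks. It stays within the natural numbers by substituting `z = 2 ^ (n ^ 2 + 1)`,
which is larger than any number of packings, and by working modulo `z ^ (k + 1)`, where
`z ^ (k + 1) - 1` takes the place of `-1`.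
-/

/-! ### Inclusion-exclusion for matchings -/

section ArcSets

open Finset

variable {V R : Type*} [DecidableEq V]

open Classical in
theorem prod_one_add_sum_fiberwise {α ι : Type*} [DecidableEq ι] [CommSemiring R]
    (f : α → ι) (g : α → R) (E : Finset α) (s : Finset ι) :
    ∏ j ∈ s, (1 + ∑ x ∈ E with f x = j, g x) =
      ∑ P ∈ E.powerset.filter fun P : Finset _ => Set.InjOn f P ∧ P.image f ⊆ s, ∏ x ∈ P, g x := by
  induction E using Finset.induction_on generalizing s with
  | empty => simp [filter_singleton]
  | insert x E hx ih =>
    have hmem {P : Finset α} (hP : P ∈ E.powerset) : x ∉ P := fun h => hx (mem_powerset.mp hP h)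
    have hins {P : Finset α} (hP : P ∈ E.powerset) :
        (Set.InjOn f ↑(insert x P) ∧ (insert x P).image f ⊆ s) ↔
          f x ∈ s ∧ Set.InjOn f P ∧ P.image f ⊆ s.erase (f x) := by
      rw [coe_insert, Set.injOn_insert (by simpa using hmem hP), image_insert, insert_subset_iff,
        subset_erase, ← coe_image, mem_coe]
      tauto
    have hrest : ∑ P ∈ E.powerset, (if Set.InjOn f ↑(insert x P) ∧ (insert x P).image f ⊆ s
          then ∏ y ∈ insert x P, g y else 0) =
        if f x ∈ s then g x * ∏ j ∈ s.erase (f x), (1 + ∑ y ∈ E with f y = j, g y) else 0 := by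
      rw [ih, mul_sum, sum_filter]
      split_ifs with hs
      · refine sum_congr rfl fun P hP => ?_
        rw [prod_insert (hmem hP)]
        exact if_congr ((hins hP).trans (and_iff_right hs)) rfl rfl
      · exact sum_eq_zero fun P hP => if_neg fun h => hs ((hins hP).mp h).1
    rw [sum_filter, sum_powerset_insert hx, ← sum_filter, ← ih s, hrest]
    by_cases hs : f x ∈ s
    · have hother : ∏ j ∈ s.erase (f x), (1 + ∑ y ∈ insert x E with f y = j, g y) =
          ∏ j ∈ s.erase (f x), (1 + ∑ y ∈ E with f y = j, g y) :=
        prod_congr rfl fun j hj => by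
          rw [filter_insert, if_neg (ne_of_mem_erase hj).symm]
      rw [if_pos hs, ← mul_prod_erase s _ hs, ← mul_prod_erase s _ hs, hother, filter_insert,
        if_pos rfl, sum_insert (by simp [hx])]
      ring
    · rw [if_neg hs, add_zero]
      refine prod_congr rfl fun j hj => ?_
      rw [filter_insert, if_neg fun h : f x = j => hs (h ▸ hj)]

variable [CommRing R]

theorem sum_powerset_superset_neg_one_pow {A I : Finset V} (hI : I ⊆ A) :
    ∑ T ∈ A.powerset with I ⊆ T, (-1 : R) ^ #(A \ T) = if I = A then 1 else 0 := by
  calc ∑ T ∈ A.powerset with I ⊆ T, (-1 : R) ^ #(A \ T)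
      = ∑ T ∈ A.powerset, (∏ _a ∈ T, 1) * ∏ a ∈ A \ T, if a ∈ I then 0 else (-1 : R) := by
        rw [sum_filter]
        refine sum_congr rfl fun T _ => ?_
        rw [prod_const_one, one_mul]
        split_ifs with h
        · rw [← prod_const]
          refine prod_congr rfl fun a ha => ?_
          rw [if_neg fun haI => (mem_sdiff.mp ha).2 (h haI)]
        · obtain ⟨a, haI, haT⟩ := not_subset.mp h
          have hzero : ∏ a ∈ A \ T, (if a ∈ I then 0 else (-1 : R)) = 0 :=
            prod_eq_zero (mem_sdiff.mpr ⟨hI haI, haT⟩) (if_pos haI)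
          rw [hzero]
    _ = ∏ a ∈ A, (1 + if a ∈ I then 0 else (-1 : R)) := (prod_add _ _ A).symm
    _ = ∏ a ∈ A, if a ∈ I then (1 : R) else 0 := prod_congr rfl fun a _ => by split_ifs <;> ring
    _ = if I = A then 1 else 0 := by
        rw [prod_ite_zero, prod_const_one]
        exact if_congr ⟨fun h => hI.antisymm h, fun h => h.ge⟩ rfl rfl

/-- A set of arcs is a matching if no two of its arcs share an endpoint, and no arc starts where an
arc ends. -/
def IsArcMatching (P : Finset (V × V)) : Prop :=
  Set.InjOn Prod.fst (P : Set (V × V)) ∧ Set.InjOn Prod.snd (P : Set (V × V)) ∧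
    Disjoint (P.image Prod.fst) (P.image Prod.snd)

variable [Fintype V]

open Classical in
theorem prod_one_add_mul_card_arcs (E : Finset (V × V)) (A T : Finset V) (z : R) :
    ∏ j ∈ univ \ A, (1 + z * (#{i ∈ T | (j, i) ∈ E} : R)) =
      ∑ P ∈ E.powerset.filter fun P : Finset _ => Set.InjOn Prod.fst (P : Set (V × V)) ∧
        Disjoint (P.image Prod.fst) A ∧ P.image Prod.snd ⊆ T, z ^ #P := by
  have hfactor (j : V) : z * (#{i ∈ T | (j, i) ∈ E} : R) =
      ∑ x ∈ E.filter (fun x => x.2 ∈ T) with x.1 = j, z := by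
    have hcard : #{i ∈ T | (j, i) ∈ E} = #{x ∈ E.filter (fun x => x.2 ∈ T) | x.1 = j} :=
      card_nbij' (fun i => (j, i)) Prod.snd (by simp +contextual [Set.MapsTo])
        (by grind [Set.MapsTo]) (by simp [Set.LeftInvOn])
        (by simp +contextual [Set.RightInvOn, Set.LeftInvOn])
    rw [hcard, sum_const, nsmul_eq_mul, mul_comm]
  simp_rw [hfactor, prod_one_add_sum_fiberwise, prod_const]
  refine sum_congr (Finset.ext fun P => ?_) fun _ _ => rfl
  simp only [mem_filter, mem_powerset, subset_iff, disjoint_left, mem_sdiff,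
    mem_univ, true_and, mem_image]
  grind

open Classical in
theorem sum_powerset_neg_one_pow_mul_prod_arcs (E : Finset (V × V)) (A : Finset V) (z : R) :
    ∑ T ∈ A.powerset, (-1) ^ #(A \ T) * ∏ j ∈ univ \ A, (1 + z * (#{i ∈ T | (j, i) ∈ E} : R)) =
      ∑ P ∈ E.powerset.filter fun P : Finset _ => Set.InjOn Prod.fst (P : Set (V × V)) ∧
        Disjoint (P.image Prod.fst) (P.image Prod.snd) ∧ P.image Prod.snd = A, z ^ #P := by
  simp_rw [prod_one_add_mul_card_arcs, mul_sum, sum_filter]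
  rw [sum_comm]
  refine sum_congr rfl fun P _ => ?_
  calc ∑ T ∈ A.powerset, (if Set.InjOn Prod.fst (P : Set (V × V)) ∧
          Disjoint (P.image Prod.fst) A ∧ P.image Prod.snd ⊆ T
          then (-1) ^ #(A \ T) * z ^ #P else 0)
      = if Set.InjOn Prod.fst (P : Set (V × V)) ∧ Disjoint (P.image Prod.fst) A then
          (∑ T ∈ A.powerset with P.image Prod.snd ⊆ T, (-1) ^ #(A \ T)) * z ^ #P else 0 := by
        split_ifs with h
        · rw [sum_mul, sum_filter]
          simp only [h.1, h.2, true_and]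
        · exact sum_eq_zero fun T _ => if_neg fun h' => h ⟨h'.1, h'.2.1⟩
    _ = _ := by
        by_cases hA : P.image Prod.snd ⊆ A
        · rw [sum_powerset_superset_neg_one_pow hA]
          grind
        · have hempty : A.powerset.filter (fun T => P.image Prod.snd ⊆ T) = ∅ :=
            filter_eq_empty_iff.mpr fun T hT h => hA (h.trans (mem_powerset.mp hT))
          rw [hempty, sum_empty, zero_mul, ite_self, if_neg fun h => hA h.2.2.le]

open Classical in
theorem sum_powersetCard_neg_one_pow_mul_prod_arcs (E : Finset (V × V)) {k : ℕ} {z : R}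
    (hz : z ^ (k + 1) = 0) :
    ∑ A ∈ univ.powersetCard k, ∑ T ∈ A.powerset, (-1) ^ #(A \ T) *
        ∏ j ∈ univ \ A, (1 + z * (#{i ∈ T | (j, i) ∈ E} : R)) =
      #{P ∈ E.powersetCard k | IsArcMatching P} * z ^ k := by
  have hfst (P : Finset (V × V)) :
      (∑ A ∈ univ.powersetCard k, if Set.InjOn Prod.fst (P : Set (V × V)) ∧
        Disjoint (P.image Prod.fst) (P.image Prod.snd) ∧ P.image Prod.snd = A
        then z ^ #P else 0) =
      if Set.InjOn Prod.fst (P : Set (V × V)) ∧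
        Disjoint (P.image Prod.fst) (P.image Prod.snd) ∧ #(P.image Prod.snd) = k
        then z ^ #P else 0 := by
    simp only [ite_and, sum_ite_irrel, sum_const_zero, sum_ite_eq, mem_powersetCard_univ]
  simp_rw [sum_powerset_neg_one_pow_mul_prod_arcs, sum_filter]
  rw [sum_comm]
  simp_rw [hfst]
  rw [← sum_filter, ← nsmul_eq_mul, ← sum_const]
  symm
  refine sum_subset_zero_on_sdiff (fun P => ?_) (fun P hP => ?_) fun P hP => ?_
  · simp only [mem_filter, mem_powersetCard, mem_powerset]
    rintro ⟨⟨hE, hk⟩, hfst, hsnd, hdisj⟩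
    exact ⟨hE, hfst, hdisj, (card_image_of_injOn hsnd).trans hk⟩
  · simp only [mem_sdiff, mem_filter, mem_powersetCard, mem_powerset] at hP
    obtain ⟨⟨hE, hfst, hdisj, hk⟩, hnot⟩ := hP
    have hle : k ≤ #P := hk ▸ card_image_le
    have hne : k ≠ #P := fun h =>
      hnot ⟨⟨hE, h.symm⟩, hfst, card_image_iff.mp (hk.trans h), hdisj⟩
    exact pow_eq_zero_of_le (lt_of_le_of_ne hle hne) hz
  · rw [(mem_powersetCard.mp (mem_filter.mp hP).1).2]

end ArcSets

section Packings

open Finset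

variable {n : ℕ}

/-- The two-element set underlying an arc. -/
def arcEnds (x : Fin n × Fin n) : Finset (Fin n) := {x.1, x.2}

/-- The members of a family of pairs, each one directed from its smaller to its larger element. -/
def increasingArcs (F : Finset (Finset (Fin n))) : Finset (Fin n × Fin n) :=
  univ.filter fun x => x.1 < x.2 ∧ arcEnds x ∈ F

theorem mem_increasingArcs {F : Finset (Finset (Fin n))} {x : Fin n × Fin n} :
    x ∈ increasingArcs F ↔ x.1 < x.2 ∧ arcEnds x ∈ F := by
  simp [increasingArcs]

theorem injOn_arcEnds_increasingArcs (F : Finset (Finset (Fin n))) :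
    Set.InjOn arcEnds (increasingArcs F : Set (Fin n × Fin n)) := by
  intro x hx y hy hxy
  have hx' := (mem_increasingArcs.mp hx).1
  have hy' := (mem_increasingArcs.mp hy).1
  have hmem (a : Fin n) : (a = x.1 ∨ a = x.2) ↔ (a = y.1 ∨ a = y.2) := by
    simpa [arcEnds] using Finset.ext_iff.mp hxy a
  have := hmem x.1
  have := hmem x.2
  have := hmem y.1
  grind

theorem image_arcEnds_increasingArcs {F : Finset (Finset (Fin n))} (hF : ∀ A ∈ F, #A = 2) :
    (increasingArcs F).image arcEnds = F := by
  ext A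
  simp only [mem_image, mem_increasingArcs]
  refine ⟨fun ⟨x, hx, h⟩ => h ▸ hx.2, fun hA => ?_⟩
  obtain ⟨a, b, hab, rfl⟩ := card_eq_two.mp (hF A hA)
  rcases hab.lt_or_gt with h | h
  · exact ⟨(a, b), ⟨h, hA⟩, rfl⟩
  · exact ⟨(b, a), ⟨h, (pair_comm a b).subst (motive := (· ∈ F)) hA⟩, pair_comm b a⟩

theorem pairwise_disjoint_image_arcEnds_iff {F : Finset (Finset (Fin n))}
    {P : Finset (Fin n × Fin n)} (hP : P ⊆ increasingArcs F) :
    (∀ A ∈ P.image arcEnds, ∀ B ∈ P.image arcEnds, A ≠ B → Disjoint A B) ↔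
      IsArcMatching P := by
  have hinj := (injOn_arcEnds_increasingArcs F).mono hP
  have hlt {x} (hx : x ∈ P) : x.1 < x.2 := (mem_increasingArcs.mp (hP hx)).1
  have harcs : (∀ A ∈ P.image arcEnds, ∀ B ∈ P.image arcEnds, A ≠ B → Disjoint A B) ↔
      ∀ x ∈ P, ∀ y ∈ P, x ≠ y → x.1 ≠ y.1 ∧ x.1 ≠ y.2 ∧ x.2 ≠ y.1 ∧ x.2 ≠ y.2 := by
    simp only [forall_mem_image]
    refine forall₂_congr fun x hx => forall₂_congr fun y hy => imp_congr (hinj.ne_iff hx hy) ?_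
    simp only [arcEnds, disjoint_left, mem_insert, mem_singleton]
    grind
  have hends : Disjoint (P.image Prod.fst) (P.image Prod.snd) ↔
      ∀ x ∈ P, ∀ y ∈ P, x.1 ≠ y.2 := by
    rw [disjoint_left, forall_mem_image]
    simp only [mem_image, not_exists, not_and, ne_comm]
  rw [harcs, IsArcMatching, hends]
  constructor
  · intro h
    refine ⟨fun x hx y hy hxy => ?_, fun x hx y hy hxy => ?_, fun x hx y hy hxy => ?_⟩
    · exact by_contra fun hne => (h x hx y hy hne).1 hxy
    · exact by_contra fun hne => (h x hx y hy hne).2.2.2 hxy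
    · by_cases hne : x = y
      · exact (hlt hx).ne (hne ▸ hxy)
      · exact (h x hx y hy hne).2.1 hxy
  · rintro ⟨hfst, hsnd, hend⟩ x hx y hy hne
    exact ⟨fun h => hne (hfst hx hy h), hend x hx y hy, (hend y hy x hx).symm,
      fun h => hne (hsnd hx hy h)⟩

open Classical in
theorem numPackings_eq_card_arcMatchings {F : Finset (Finset (Fin n))} (hF : ∀ A ∈ F, #A = 2)
    (k : ℕ) :
    numPackings F k = #{P ∈ (increasingArcs F).powersetCard k | IsArcMatching P} := by
  have hinj := injOn_arcEnds_increasingArcs F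
  refine (card_nbij (image arcEnds) (fun P hP => ?_) (fun P hP P' hP' h => ?_)
    fun Q hQ => ?_).symm
  · obtain ⟨⟨hE, hk⟩, hP⟩ := by simpa only [mem_coe, mem_filter, mem_powersetCard] using hP
    rw [mem_coe, mem_filter, mem_powersetCard, card_image_of_injOn (hinj.mono hE)]
    exact ⟨⟨(image_subset_image hE).trans (image_arcEnds_increasingArcs hF).le, hk⟩,
      (pairwise_disjoint_image_arcEnds_iff hE).mpr hP⟩
  · have hE := (mem_powersetCard.mp (mem_filter.mp hP).1).1
    have hE' := (mem_powersetCard.mp (mem_filter.mp hP').1).1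
    have himage : arcEnds '' (P : Set (Fin n × Fin n)) = arcEnds '' P' := by
      exact_mod_cast congrArg (fun Q : Finset (Finset (Fin n)) => (Q : Set (Finset (Fin n)))) h
    exact coe_injective ((hinj.image_eq_image_iff hE hE').mp himage)
  · obtain ⟨⟨hE, hk⟩, hQ⟩ := by simpa only [mem_coe, mem_filter, mem_powersetCard] using hQ
    obtain ⟨P, hP, rfl⟩ := subset_image_iff.mp (hE.trans (image_arcEnds_increasingArcs hF).ge)
    rw [card_image_of_injOn (hinj.mono hP)] at hk
    refine ⟨P, ?_, rfl⟩
    rw [mem_coe, mem_filter, mem_powersetCard]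
    exact ⟨⟨hP, hk⟩, (pairwise_disjoint_image_arcEnds_iff hP).mp hQ⟩

theorem numPackings_lt {F : Finset (Finset (Fin n))} (hF : ∀ A ∈ F, #A = 2) (k : ℕ) :
    numPackings F k < 2 ^ (n * n + 1) := by
  have hF' : #F ≤ n * n := calc
    #F ≤ #((univ : Finset (Fin n)).powersetCard 2) :=
      card_le_card fun A hA => mem_powersetCard_univ.mpr (hF A hA)
    _ = n.choose 2 := by simp
    _ ≤ n * n := (Nat.choose_le_pow n 2).trans_eq (by ring)
  calc numPackings F k ≤ #F.powerset :=
        card_le_card ((filter_subset _ _).trans fun _ hP =>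
          mem_powerset.mpr (mem_powersetCard.mp hP).1)
    _ = 2 ^ #F := card_powerset F
    _ < 2 ^ (n * n + 1) := Nat.pow_lt_pow_right one_lt_two (by omega)

end Packings

/-! ### Sums over pairs of a set and a subset -/

section Ranking

open Finset

/-- The number of pairs of a `k`-subset of an `m`-set and a subset of it. -/
def numPairs (m k : ℕ) : ℕ := m.choose k * 2 ^ k

theorem numPairs_zero_right (m : ℕ) : numPairs m 0 = 1 := by simp [numPairs]

theorem numPairs_succ_succ (m k : ℕ) :
    numPairs (m + 1) (k + 1) = numPairs m (k + 1) + (numPairs m k + numPairs m k) := by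
  rw [numPairs, Nat.choose_succ_succ, numPairs, numPairs]
  ring

theorem numPairs_mul_div (m k : ℕ) :
    numPairs (m + 1) k * (m + 1 - k) / (m + 1) = numPairs m k := by
  refine Nat.div_eq_of_eq_mul_left m.succ_pos ?_
  calc numPairs (m + 1) k * (m + 1 - k) = (m + 1).choose k * (m + 1 - k) * 2 ^ k := by
        rw [numPairs]; ring
    _ = numPairs m k * (m + 1) := by rw [← Nat.choose_mul_succ_eq, numPairs]; ring

theorem numPairs_mul_div_succ_right (n i : ℕ) :
    numPairs n i * (n - i) / (i + 1) * 2 = numPairs n (i + 1) := by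
  have h : numPairs n i * (n - i) / (i + 1) = n.choose (i + 1) * 2 ^ i := by
    refine Nat.div_eq_of_eq_mul_left i.succ_pos ?_
    calc numPairs n i * (n - i) = n.choose i * (n - i) * 2 ^ i := by rw [numPairs]; ring
      _ = n.choose (i + 1) * 2 ^ i * (i + 1) := by rw [← Nat.choose_succ_right_eq]; ring
  rw [h, numPairs, pow_succ, mul_assoc]

theorem numPairs_le_two_pow (n k : ℕ) : numPairs n k ≤ 2 ^ (n + k) := by
  rw [numPairs, pow_add]
  exact Nat.mul_le_mul_right _ (Nat.choose_le_two_pow n k)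

variable {R : Type*} [CommSemiring R] (w : ℕ → Finset ℕ → R) (u : R)

/-- The sum over all pairs of a `k`-subset `A` of `{0, …, m - 1}` and a subset `T` of `A` of the
products of `u` for each element of `A \ T` and `w j ({i ∈ T | j < i} ∪ S)` for each `j ∉ A`. The
set `S` collects the elements of `T` that were split off at the top of the range. -/
def pairSum (m k : ℕ) (S : Finset ℕ) : R :=
  ∑ A ∈ (range m).powersetCard k, ∑ T ∈ A.powerset,
    u ^ #(A \ T) * ∏ j ∈ range m \ A, w j ({i ∈ T | j < i} ∪ S)

theorem pairSum_succ_zero (m : ℕ) (S : Finset ℕ) :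
    pairSum w u (m + 1) 0 S = w m S * pairSum w u m 0 S := by
  simp [pairSum, prod_range_succ, mul_comm]

theorem pairSum_succ_succ (m k : ℕ) (S : Finset ℕ) :
    pairSum w u (m + 1) (k + 1) S = w m S * pairSum w u m (k + 1) S +
      (u * pairSum w u m k S + pairSum w u m k (insert m S)) := by
  have hnot {l : ℕ} {A : Finset ℕ} (hA : A ∈ (range m).powersetCard l) : m ∉ A :=
    fun h => notMem_range_self ((mem_powersetCard.mp hA).1 h)
  have hdisj : Disjoint ((range m).powersetCard (k + 1))
      (((range m).powersetCard k).image (insert m)) := by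
    rw [disjoint_right, forall_mem_image]
    exact fun A _ h => hnot h (mem_insert_self m A)
  have hinj : Set.InjOn (insert m) ((range m).powersetCard k : Set (Finset ℕ)) :=
    fun A hA B hB h => (erase_insert (hnot hA)).symm.trans
      ((congrArg (erase · m) h).trans (erase_insert (hnot hB)))
  rw [pairSum, range_add_one, powersetCard_succ_insert notMem_range_self, sum_union hdisj,
    sum_image hinj]
  congr 1
  · rw [pairSum, mul_sum]
    refine sum_congr rfl fun A hA => ?_
    rw [mul_sum]
    refine sum_congr rfl fun T hT => ?_
    have htop : {i ∈ T | m < i} = ∅ := filter_eq_empty_iff.mpr fun i hi =>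
      (mem_range.mp ((mem_powersetCard.mp hA).1 (mem_powerset.mp hT hi))).not_gt
    rw [insert_sdiff_of_notMem _ (hnot hA), prod_insert (by simp), htop, empty_union]
    ring
  · rw [pairSum, pairSum, mul_sum, ← sum_add_distrib]
    refine sum_congr rfl fun A hA => ?_
    have hrange : insert m (range m) \ insert m A = range m \ A := by
      rw [insert_sdiff_insert, sdiff_insert_of_notMem notMem_range_self]
    rw [sum_powerset_insert (hnot hA), mul_sum, hrange]
    congr 1
    · refine sum_congr rfl fun T hT => ?_
      have hmT : m ∉ T := fun h => hnot hA (mem_powerset.mp hT h)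
      rw [insert_sdiff_of_notMem _ hmT, card_insert_of_notMem fun h => hnot hA (mem_sdiff.mp h).1,
        pow_succ']
      ring
    · refine sum_congr rfl fun T _ => ?_
      rw [insert_sdiff_insert, sdiff_insert_of_notMem (hnot hA)]
      congr 1
      refine prod_congr rfl fun j hj => ?_
      rw [filter_insert, if_pos (mem_range.mp (mem_sdiff.mp hj).1), insert_union, union_insert]

/-- The summand of `pairSum w u m k S` number `i`, in an order in which the pairs with `m - 1 ∉ A`
come first, followed by those with `m - 1 ∈ A \ T` and then those with `m - 1 ∈ T`, each of the
three blocks being ordered recursively. -/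
def pairTerm : (m k i : ℕ) → Finset ℕ → R
  | 0, _, _, _ => 1
  | m + 1, k, i, S =>
    if i < numPairs m k then w m S * pairTerm m k i S
    else if i - numPairs m k < numPairs m (k - 1) then
      u * pairTerm m (k - 1) (i - numPairs m k) S
    else pairTerm m (k - 1) (i - numPairs m k - numPairs m (k - 1)) (insert m S)

theorem sum_pairTerm (m k : ℕ) (S : Finset ℕ) :
    ∑ i ∈ range (numPairs m k), pairTerm w u m k i S = pairSum w u m k S := by
  induction m generalizing k S with
  | zero =>
    cases k with
    | zero => simp [pairSum, pairTerm, numPairs]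
    | succ k =>
      rw [pairSum, powersetCard_eq_empty.mpr (by simp), sum_empty]
      simp [numPairs]
  | succ m ih =>
    cases k with
    | zero =>
      rw [pairSum_succ_zero, ← ih, numPairs_zero_right, numPairs_zero_right]
      simp [pairTerm, numPairs_zero_right]
    | succ k =>
      rw [pairSum_succ_succ, numPairs_succ_succ, sum_range_add, sum_range_add, ← ih, ← ih, ← ih,
        mul_sum, mul_sum]
      congr 1
      · exact sum_congr rfl fun i hi => by rw [pairTerm, if_pos (mem_range.mp hi)]
      · congr 1
        · exact sum_congr rfl fun i hi => by
            rw [pairTerm, if_neg (by omega), Nat.add_sub_cancel, Nat.add_sub_cancel_left,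
              if_pos (mem_range.mp hi)]
        · exact sum_congr rfl fun i _ => by
            rw [pairTerm, if_neg (by omega), Nat.add_sub_cancel, Nat.add_sub_cancel_left,
              if_neg (by omega), Nat.add_sub_cancel_left]

theorem cast_pairSum (w : ℕ → Finset ℕ → ℕ) (u m k : ℕ) (S : Finset ℕ) :
    ((pairSum w u m k S : ℕ) : R) = pairSum (fun j T => (w j T : R)) u m k S := by
  simp [pairSum]

theorem pairSum_eq_sum_fin (n k : ℕ) :
    pairSum w u n k ∅ = ∑ A ∈ (univ : Finset (Fin n)).powersetCard k, ∑ T ∈ A.powerset,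
      u ^ #(A \ T) * ∏ j ∈ univ \ A, w j ({i ∈ T | j < i}.map Fin.valEmbedding) := by
  have hrange : range n = (univ : Finset (Fin n)).map Fin.valEmbedding := by
    rw [Fin.map_valEmbedding_univ, Nat.Iio_eq_range]
  have hpowerset (A : Finset (Fin n)) : (A.map Fin.valEmbedding).powerset =
      A.powerset.map (mapEmbedding Fin.valEmbedding).toEmbedding := by
    ext T
    simp only [mem_powerset, mem_map, subset_map_iff, RelEmbedding.coe_toEmbedding,
      mapEmbedding_apply]
    exact ⟨fun ⟨U, hU, h⟩ => ⟨U, hU, h.symm⟩, fun ⟨U, hU, h⟩ => ⟨U, hU, h.symm⟩⟩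
  rw [pairSum, hrange, powersetCard_map, sum_map]
  refine sum_congr rfl fun A _ => ?_
  rw [RelEmbedding.coe_toEmbedding, mapEmbedding_apply, hpowerset, sum_map]
  refine sum_congr rfl fun T _ => ?_
  rw [RelEmbedding.coe_toEmbedding, mapEmbedding_apply, ← Finset.map_sdiff, ← Finset.map_sdiff,
    card_map, prod_map]
  refine congrArg _ (prod_congr rfl fun j _ => ?_)
  rw [union_empty, filter_map]
  rfl

theorem pairTerm_pos {w : ℕ → Finset ℕ → ℕ} {u : ℕ} (hw : ∀ j T, 0 < w j T) (hu : 0 < u)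
    (m k i : ℕ) (S : Finset ℕ) : 0 < pairTerm w u m k i S := by
  induction m generalizing k i S with
  | zero => exact one_pos
  | succ m ih =>
    rw [pairTerm]
    split_ifs
    exacts [Nat.mul_pos (hw m S) (ih _ _ _), Nat.mul_pos hu (ih _ _ _), ih _ _ _]

theorem pairTerm_le {w : ℕ → Finset ℕ → ℕ} {u C n : ℕ} (hw : ∀ j, ∀ T ⊆ range n, w j T ≤ C)
    (hu : u ≤ C) (hC : 0 < C) {m : ℕ} (hm : m ≤ n) (k i : ℕ) {S : Finset ℕ} (hS : S ⊆ range n) :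
    pairTerm w u m k i S ≤ C ^ m := by
  induction m generalizing k i S with
  | zero => exact le_rfl
  | succ m ih =>
    have ih := ih (by omega)
    have hS' : insert m S ⊆ range n := insert_subset (mem_range.mpr hm) hS
    rw [pairTerm, pow_succ']
    split_ifs
    · exact Nat.mul_le_mul (hw m S hS) (ih _ _ hS)
    · exact Nat.mul_le_mul hu (ih _ _ hS)
    · exact (ih _ _ hS').trans (Nat.le_mul_of_pos_left _ hC)

end Ranking

section Encoding

open Finset RAM

theorem sum_two_pow_div_two_pow_mod_two (T : Finset ℕ) (i : ℕ) :
    (∑ a ∈ T, 2 ^ a) / 2 ^ i % 2 = if i ∈ T then 1 else 0 := by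
  have hbit : (∑ a ∈ T, 2 ^ a).testBit i ↔ i ∈ T := by
    rw [← Nat.mem_bitIndices, ← List.mem_toFinset, toFinset_bitIndices_sum_two_pow]
  rw [← Nat.toNat_testBit]
  split_ifs with h
  · rw [hbit.mpr h, Bool.toNat_true]
  · rw [Bool.eq_false_iff.mpr (h ∘ hbit.mp), Bool.toNat_false]

theorem sum_range_sum_two_pow_div_mod_mul {n : ℕ} {T : Finset ℕ} (hT : T ⊆ range n) (f : ℕ → ℕ) :
    ∑ i ∈ range n, (∑ a ∈ T, 2 ^ a) / 2 ^ i % 2 * f i = ∑ i ∈ T, f i := by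
  simp_rw [sum_two_pow_div_two_pow_mod_two, ite_mul, one_mul, zero_mul]
  rw [sum_ite_mem, inter_eq_right.mpr hT]

theorem RAM.pairMatrix_apply {n : ℕ} (F : Finset (Finset (Fin n))) (j i : Fin n) :
    pairMatrix F (j * n + i) = if {j, i} ∈ F then 1 else 0 := by
  refine (Finsupp.onFinset_apply ..).trans (if_congr ⟨?_, fun h => ⟨j, i, rfl, h⟩⟩ rfl rfl)
  rintro ⟨j', i', h, hF⟩
  obtain rfl : i = i' := by
    have := congrArg (· % n) h
    simpa [Nat.add_mod, Nat.mod_eq_of_lt, Fin.ext_iff] using this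
  obtain rfl : j = j' := Fin.ext (Nat.eq_of_mul_eq_mul_right i.pos (Nat.add_right_cancel h))
  exact hF

theorem RAM.pairMatrix_le_one {n : ℕ} (F : Finset (Finset (Fin n))) (a : ℕ) :
    pairMatrix F a ≤ 1 := by
  refine (Finsupp.onFinset_apply ..).trans_le ?_
  split_ifs
  exacts [le_rfl, zero_le_one]

/-- The factor `1 + z d` of a vertex `j`, where `d` counts the arcs from `j` into `T` and `M` is the
adjacency matrix on `n` vertices, stored row by row. -/
def degreeWeight (M : ℕ → ℕ) (n z j : ℕ) (T : Finset ℕ) : ℕ := 1 + z * ∑ i ∈ T, M (j * n + i)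

theorem degreeWeight_pos (M : ℕ → ℕ) (n z j : ℕ) (T : Finset ℕ) : 0 < degreeWeight M n z j T := by
  rw [degreeWeight]
  omega

theorem degreeWeight_pairMatrix {n : ℕ} (F : Finset (Finset (Fin n))) (z : ℕ) (j : Fin n)
    (T : Finset (Fin n)) :
    degreeWeight (pairMatrix F) n z j ({i ∈ T | j < i}.map Fin.valEmbedding) =
      1 + z * #{i ∈ T | (j, i) ∈ increasingArcs F} := by
  rw [degreeWeight, sum_map, card_filter, sum_filter]
  congr 2
  refine sum_congr rfl fun i _ => ?_
  rw [Fin.valEmbedding_apply, pairMatrix_apply]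
  simp only [mem_increasingArcs, arcEnds, ite_and]

/-- Kronecker substitution: modulo `z ^ (k + 1)` only the coefficient of `z ^ k` of the signed sum
is left, and it can be read off as soon as it is less than `z`. -/
theorem pairSum_mod_div_eq_numPackings {n : ℕ} {F : Finset (Finset (Fin n))}
    (hF : ∀ A ∈ F, #A = 2) {k z : ℕ} (hz : numPackings F k < z) :
    pairSum (degreeWeight (pairMatrix F) n z) (z ^ (k + 1) - 1) n k ∅ % z ^ (k + 1) / z ^ k =
      numPackings F k := by
  classical
  have hpos : 0 < z := by omega
  have hnil : (z : ZMod (z ^ (k + 1))) ^ (k + 1) = 0 := by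
    exact_mod_cast ZMod.natCast_self (z ^ (k + 1))
  have hneg : ((z ^ (k + 1) - 1 : ℕ) : ZMod (z ^ (k + 1))) = -1 := by
    rw [Nat.cast_sub (Nat.pow_pos hpos), Nat.cast_pow, hnil, Nat.cast_one, zero_sub]
  have hcast : ((pairSum (degreeWeight (pairMatrix F) n z) (z ^ (k + 1) - 1) n k ∅ : ℕ) :
      ZMod (z ^ (k + 1))) = (numPackings F k * z ^ k : ℕ) := by
    rw [cast_pairSum, pairSum_eq_sum_fin, hneg]
    simp_rw [degreeWeight_pairMatrix]
    push_cast
    rw [sum_powersetCard_neg_one_pow_mul_prod_arcs _ hnil, numPackings_eq_card_arcMatchings hF]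
  have hlt : numPackings F k * z ^ k < z ^ (k + 1) := by
    rw [pow_succ']
    exact Nat.mul_lt_mul_of_pos_right hz (Nat.pow_pos hpos)
  rw [(ZMod.natCast_eq_natCast_iff' _ _ _).mp hcast, Nat.mod_eq_of_lt hlt,
    Nat.mul_div_cancel _ (Nat.pow_pos hpos)]

end Encoding

/-! ### Total correctness with bounds on time and space -/

namespace RAM

section Hoare

variable {M : ℕ →₀ ℕ} {R L : ℕ}

/-- States with memory `M` in which only the registers below `R` are used, with contents at most
`L`. -/
structure Bounded (M : ℕ →₀ ℕ) (R L : ℕ) (s : State) : Prop where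
  mem_eq : s.mem = M
  reg_le (r : ℕ) : s.reg r ≤ L
  reg_eq_zero (r : ℕ) : R ≤ r → s.reg r = 0

/-- An upper bound on the cost of an instruction that only handles numbers up to `L`. -/
def stepTime (L : ℕ) : ℕ := (1 + Nat.size L) * (1 + Nat.size L)

/-- An upper bound on the space occupied by a state that satisfies `Bounded M R L`. -/
def space (M : ℕ →₀ ℕ) (R L : ℕ) : ℕ := R * (R + Nat.size L) + cellBits M

theorem one_add_size_le_stepTime {x : ℕ} (hx : x ≤ L) : 1 + Nat.size x ≤ stepTime L :=
  (Nat.add_le_add_left (Nat.size_le_size hx) 1).trans (Nat.le_mul_of_pos_right _ (by omega))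

theorem one_add_size_add_size_le_stepTime {x y : ℕ} (hx : x ≤ L) (hy : y ≤ L) :
    1 + Nat.size x + Nat.size y ≤ stepTime L := by
  have hx := Nat.size_le_size hx
  have hy := Nat.size_le_size hy
  rw [stepTime]
  nlinarith

theorem Op.cost_le_stepTime (o : Op) {x y : ℕ} (hx : x ≤ L) (hy : y ≤ L) :
    o.cost x y ≤ stepTime L := by
  cases o with
  | add | sub => exact one_add_size_add_size_le_stepTime hx hy
  | mul | div =>
    exact Nat.mul_le_mul (Nat.add_le_add_left (Nat.size_le_size hx) 1)
      (Nat.add_le_add_left (Nat.size_le_size hy) 1)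

theorem Bounded.bits_le {s : State} (h : Bounded M R L s) : s.bits ≤ space M R L := by
  have hsupport : s.reg.support ⊆ Finset.range R := fun r hr => by
    by_contra hR
    exact Finsupp.mem_support_iff.mp hr (h.reg_eq_zero r (by simpa using hR))
  have hcell (r : ℕ) (hr : r ∈ s.reg.support) :
      Nat.size r + Nat.size (s.reg r) ≤ R + Nat.size L := by
    have hrR : Nat.size r ≤ r := Nat.size_le.mpr Nat.lt_two_pow_self
    have hlt := Finset.mem_range.mp (hsupport hr)
    have hsize := Nat.size_le_size (h.reg_le r)
    omega
  rw [State.bits, space, h.mem_eq]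
  refine Nat.add_le_add_right ((Finset.sum_le_card_nsmul _ _ _ hcell).trans ?_) _
  exact Nat.mul_le_mul_right _ (by simpa using Finset.card_le_card hsupport)

/-- The instruction does not write to the memory, and writes a number up to `L` to a register below
`R`. -/
def Instr.Safe (R L : ℕ) : Instr → State → Prop
  | .const d c, _ => d < R ∧ c ≤ L
  | .arith o d a b, s => d < R ∧ o.eval (s.reg a) (s.reg b) ≤ L
  | .load d a, s => d < R ∧ s.mem (s.reg a) ≤ L
  | .store _ _, _ => False

theorem Bounded.update {s : State} (h : Bounded M R L s) {d v : ℕ} (hd : d < R) (hv : v ≤ L) :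
    Bounded M R L { s with reg := s.reg.update d v } where
  mem_eq := h.mem_eq
  reg_le r := by
    rw [Finsupp.update_apply]
    split_ifs
    exacts [hv, h.reg_le r]
  reg_eq_zero r hr := by
    rw [Finsupp.update_apply, if_neg (by omega), h.reg_eq_zero r hr]

theorem Instr.Safe.bounded {i : Instr} {s : State} (hi : i.Safe R L s) (h : Bounded M R L s) :
    Bounded M R L (i.exec s) := by
  cases i with
  | const | arith | load => exact h.update hi.1 hi.2
  | store => exact hi.elim

theorem Instr.Safe.cost_le {i : Instr} {s : State} (hi : i.Safe R L s) (h : Bounded M R L s) :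
    i.cost s ≤ stepTime L := by
  cases i with
  | const d c => exact one_add_size_le_stepTime hi.2
  | arith o d a b => exact o.cost_le_stepTime (h.reg_le a) (h.reg_le b)
  | load d a => exact one_add_size_add_size_le_stepTime (h.reg_le a) hi.2
  | store => exact hi.elim

/-- Total correctness of `p` from `s` on: if the registers of `s` are bounded, then `p` halts in a
state that satisfies `Q` within the time of `N` steps, and the registers stay bounded. -/
def Wp (M : ℕ →₀ ℕ) (R L : ℕ) (p : Prog) (s : State) (N : ℕ) (Q : State → Prop) : Prop :=
  Bounded M R L s → ∃ s' t b, Run p s s' t b ∧ t ≤ N * stepTime L ∧ b ≤ space M R L ∧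
    Bounded M R L s' ∧ Q s'

variable {p q : Prog} {s : State} {N N' : ℕ} {P Q : State → Prop}

theorem Wp.mono (h : Wp M R L p s N P) (hN : N ≤ N') (hQ : ∀ s', P s' → Q s') :
    Wp M R L p s N' Q := fun hs =>
  let ⟨s', t, b, hrun, ht, hb, hs', hP⟩ := h hs
  ⟨s', t, b, hrun, ht.trans (Nat.mul_le_mul_right _ hN), hb, hs', hQ s' hP⟩

theorem Wp.skip (h : Q s) : Wp M R L .skip s 1 Q := fun hs =>
  ⟨s, 1, s.bits, .skip s, by linarith [one_add_size_le_stepTime (Nat.zero_le L)], hs.bits_le, hs, h⟩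

theorem Wp.instr {i : Instr} (h : Bounded M R L s → i.Safe R L s ∧ Q (i.exec s)) :
    Wp M R L (.instr i) s 1 Q := fun hs => by
  obtain ⟨hi, hQ⟩ := h hs
  have hs' := hi.bounded hs
  exact ⟨_, _, _, .instr i s, (hi.cost_le hs).trans_eq (Nat.one_mul _).symm,
    max_le hs.bits_le hs'.bits_le, hs', hQ⟩

theorem Wp.seq (hp : Wp M R L p s N P) (hq : ∀ s', P s' → Wp M R L q s' N' Q) :
    Wp M R L (.seq p q) s (N + N') Q := fun hs => by
  obtain ⟨s₁, t₁, b₁, hrun₁, ht₁, hb₁, hs₁, hP⟩ := hp hs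
  obtain ⟨s₂, t₂, b₂, hrun₂, ht₂, hb₂, hs₂, hQ⟩ := hq s₁ hP hs₁
  exact ⟨s₂, _, _, .seq hrun₁ hrun₂, (Nat.add_le_add ht₁ ht₂).trans_eq (Nat.add_mul ..).symm,
    max_le hb₁ hb₂, hs₂, hQ⟩

theorem Wp.ite {r : ℕ} (hp : s.reg r ≠ 0 → Wp M R L p s N Q)
    (hq : s.reg r = 0 → Wp M R L q s N Q) : Wp M R L (.ite r p q) s (N + 1) Q := fun hs => by
  have htest := one_add_size_le_stepTime (hs.reg_le r)
  by_cases hr : s.reg r = 0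
  · obtain ⟨s', t, b, hrun, ht, hb, hs', hQ⟩ := hq hr hs
    exact ⟨s', _, b, .ite_false hr hrun, by linarith, hb, hs', hQ⟩
  · obtain ⟨s', t, b, hrun, ht, hb, hs', hQ⟩ := hp hr hs
    exact ⟨s', _, b, .ite_true hr hrun, by linarith, hb, hs', hQ⟩

/-- Straight-line code. -/
def Prog.block : List Instr → Prog
  | [] => .skip
  | i :: is => .seq (.instr i) (.block is)

/-- The state after straight-line code. -/
noncomputable def execBlock : List Instr → State → State
  | [], s => s
  | i :: is, s => execBlock is (i.exec s)

/-- Each instruction of straight-line code is safe at the time it is executed. -/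
def BlockSafe (R L : ℕ) : List Instr → State → Prop
  | [], _ => True
  | i :: is, s => i.Safe R L s ∧ BlockSafe R L is (i.exec s)

theorem Wp.block {is : List Instr}
    (h : Bounded M R L s → BlockSafe R L is s ∧ Q (execBlock is s)) :
    Wp M R L (.block is) s (is.length + 1) Q := fun hs => by
  obtain ⟨hsafe, hQ⟩ := h hs
  induction is generalizing s with
  | nil => exact Wp.skip hQ hs
  | cons i is ih =>
    have hseq := Wp.seq (q := .block is) (N' := is.length + 1) (Q := Q)
      (Wp.instr (Q := (· = i.exec s)) fun _ => ⟨hsafe.1, rfl⟩)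
      fun s' h hs' => by subst h; exact ih (fun _ => ⟨hsafe.2, hQ⟩) hs' hsafe.2 hQ
    exact hseq.mono (by rw [List.length_cons, Nat.add_comm]) (fun _ => id) hs

/-- The two states agree on the registers below `b`. -/
def Agree (b : ℕ) (s s' : State) : Prop := ∀ r < b, s'.reg r = s.reg r

/-- The program only writes to registers from `b` on. -/
def Prog.WritesFrom (b : ℕ) : Prog → Prop
  | .skip => True
  | .instr (.const d _) | .instr (.arith _ d _ _) | .instr (.load d _) => b ≤ d
  | .instr (.store _ _) => True
  | .seq p q | .ite _ p q => p.WritesFrom b ∧ q.WritesFrom b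
  | .loop _ p => p.WritesFrom b

theorem Agree.trans {b : ℕ} {s₁ s₂ s₃ : State} (h : Agree b s₁ s₂) (h' : Agree b s₂ s₃) :
    Agree b s₁ s₃ := fun r hr => (h' r hr).trans (h r hr)

theorem Run.agree {b t c : ℕ} {s' : State} (h : Run p s s' t c) (hp : p.WritesFrom b) :
    Agree b s s' := by
  induction h with
  | skip | loop_done => exact fun _ _ => rfl
  | instr i s =>
    intro r hr
    cases i with
    | const d | arith _ d | load d =>
      have hd : r ≠ d := (hr.trans_le hp).ne
      exact (Finsupp.update_apply ..).trans (if_neg hd)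
    | store => rfl
  | seq _ _ ih ih' => exact (ih hp.1).trans (ih' hp.2)
  | ite_true _ _ ih => exact ih hp.1
  | ite_false _ _ ih => exact ih hp.2
  | loop_step _ _ _ ih ih' => exact (ih hp).trans (ih' hp)

theorem Wp.frame {b : ℕ} (h : Wp M R L p s N Q) (hp : p.WritesFrom b) :
    Wp M R L p s N (fun s' => Agree b s s' ∧ Q s') := fun hs =>
  let ⟨s', t, c, hrun, ht, hc, hs', hQ⟩ := h hs
  ⟨s', t, c, hrun, ht, hc, hs', hrun.agree hp, hQ⟩

theorem Wp.forLoop {r b m : ℕ} {I : ℕ → State → Prop} (hp : p.WritesFrom b)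
    (hr : ∀ m s', I m s' → s'.reg r = m)
    (step : ∀ m s', Agree b s s' → I (m + 1) s' → Wp M R L p s' N (I m)) (h : I m s) :
    Wp M R L (.loop r p) s (m * (N + 1) + 1) (fun s' => Agree b s s' ∧ I 0 s') := by
  suffices H : ∀ s', Agree b s s' → I m s' → Wp M R L (.loop r p) s' (m * (N + 1) + 1)
      (fun s' => Agree b s s' ∧ I 0 s') from H s (fun _ _ => rfl) h
  intro s₁ hagree h₁ hs₁
  have htest := one_add_size_le_stepTime (hs₁.reg_le r)
  clear h
  induction m generalizing s₁ with
  | zero =>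
    exact ⟨s₁, _, _, .loop_done (hr _ _ h₁), by linarith, hs₁.bits_le, hs₁, hagree, h₁⟩
  | succ m ih =>
    obtain ⟨s₂, t₂, b₂, hrun₂, ht₂, hb₂, hs₂, h₂⟩ := step m s₁ hagree h₁ hs₁
    obtain ⟨s₃, t₃, b₃, hrun₃, ht₃, hb₃, hs₃, h₃⟩ :=
      ih s₂ (hagree.trans (hrun₂.agree hp)) h₂ hs₂ (one_add_size_le_stepTime (hs₂.reg_le r))
    have hr₁ : s₁.reg r ≠ 0 := by rw [hr _ _ h₁]; exact m.succ_ne_zero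
    exact ⟨s₃, _, _, .loop_step hr₁ hrun₂ hrun₃, by linarith, max_le hb₂ hb₃, hs₃, h₃⟩

theorem Wp.block_forLoop {is : List Instr} {r b m : ℕ} {I : ℕ → State → Prop}
    (hp : (Prog.seq (.block is) (.loop r p)).WritesFrom b) (hr : ∀ m s', I m s' → s'.reg r = m)
    (init : Bounded M R L s → BlockSafe R L is s ∧ I m (execBlock is s))
    (step : ∀ m s', Agree b s s' → I (m + 1) s' → Wp M R L p s' N (I m)) :
    Wp M R L (.seq (.block is) (.loop r p)) s (is.length + 1 + (m * (N + 1) + 1))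
      (fun s' => Agree b s s' ∧ I 0 s') :=
  ((Wp.block init).frame hp.1).seq fun _ h₁ =>
    (Wp.forLoop (p := p) hp.2 hr (fun m s' h => step m s' (h₁.1.trans h)) h₁.2).mono le_rfl
      fun _ h => ⟨h₁.1.trans h.1, h.2⟩

end Hoare

end RAM

/-! ### The summands and the numbers in the computation -/

section Scan

open Finset

variable {M : ℕ → ℕ} {n k : ℕ}

/-- The point at which the numbers of `k`-packings are substituted into their generating
polynomial; it exceeds all of them. -/
def kroneckerBase (n : ℕ) : ℕ := 2 ^ (n * n + 1)

/-- The terms of the sum over pairs that encodes the number of `k`-packings. -/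
def packingTerm (M : ℕ → ℕ) (n k : ℕ) : (m j i : ℕ) → Finset ℕ → ℕ :=
  pairTerm (degreeWeight M n (kroneckerBase n)) (kroneckerBase n ^ (k + 1) - 1)

/-- The state of a computation of the number `v`, a term of the sum over pairs, after the vertices
from `m` on have been processed. The remaining pair has rank `i` among those that use `j` of the
first `m` vertices, `mask` encodes the elements of `T` found so far, and `p` is the product of the
factors found so far. -/
def ScanData (M : ℕ → ℕ) (n k v m j i mask p : ℕ) : Prop :=
  m ≤ n ∧ j ≤ k ∧ i < numPairs m j ∧ ∃ T ⊆ Ico m n, mask = ∑ a ∈ T, 2 ^ a ∧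
    p * packingTerm M n k m j i T = v

theorem one_lt_kroneckerBase_pow (n k : ℕ) : 1 < kroneckerBase n ^ (k + 1) :=
  Nat.one_lt_pow k.succ_ne_zero (Nat.one_lt_two_pow (n * n).succ_ne_zero)

theorem packingTerm_pos (m j i : ℕ) (T : Finset ℕ) : 0 < packingTerm M n k m j i T :=
  pairTerm_pos (fun j T => degreeWeight_pos M n _ j T)
    (Nat.sub_pos_of_lt (one_lt_kroneckerBase_pow n k)) m j i T

variable {v m j i mask p : ℕ}

theorem scanData_init (hi : i < numPairs n k) :
    ScanData M n k (packingTerm M n k n k i ∅) n k i 0 1 :=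
  ⟨le_rfl, le_rfl, hi, ∅, empty_subset _, rfl, one_mul _⟩

theorem ScanData.prod_le (h : ScanData M n k v m j i mask p) : p ≤ v := by
  obtain ⟨-, -, -, T, -, -, rfl⟩ := h
  exact Nat.le_mul_of_pos_right _ (packingTerm_pos m j i T)

theorem ScanData.mask_lt (h : ScanData M n k v m j i mask p) : mask < 2 ^ n := by
  obtain ⟨-, -, -, T, hT, rfl, -⟩ := h
  exact Nat.geomSum_lt le_rfl fun a ha => (mem_Ico.mp (hT ha)).2

theorem ScanData.prod_eq (h : ScanData M n k v 0 j i mask p) : p = v := by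
  obtain ⟨-, -, -, T, -, -, rfl⟩ := h
  exact (mul_one p).symm

theorem ScanData.weight (h : ScanData M n k v (m + 1) j i mask p) (hi : i < numPairs m j) :
    ScanData M n k v m j i mask
      (p * (1 + kroneckerBase n * ∑ l ∈ range n, mask / 2 ^ l % 2 * M (m * n + l))) := by
  obtain ⟨hm, hj, -, T, hT, rfl, rfl⟩ := h
  have hTn : T ⊆ range n := fun a ha => mem_range.mpr (mem_Ico.mp (hT ha)).2
  refine ⟨by omega, hj, hi, T, hT.trans (Ico_subset_Ico_left m.le_succ), rfl, ?_⟩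
  rw [sum_range_sum_two_pow_div_mod_mul hTn, mul_assoc, packingTerm, pairTerm, if_pos hi,
    degreeWeight]

theorem ScanData.exists_eq_succ (h : ScanData M n k v (m + 1) j i mask p)
    (hi : numPairs m j ≤ i) : ∃ l, j = l + 1 := by
  rcases j with _ | l
  · have hlt := h.2.2.1
    rw [numPairs_zero_right] at hlt hi
    omega
  · exact ⟨l, rfl⟩

theorem ScanData.neg (h : ScanData M n k v (m + 1) (j + 1) i mask p)
    (hi : numPairs m (j + 1) ≤ i) (hi' : i - numPairs m (j + 1) < numPairs m j) :
    ScanData M n k v m j (i - numPairs m (j + 1)) mask (p * (kroneckerBase n ^ (k + 1) - 1)) := by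
  obtain ⟨hm, hj, -, T, hT, rfl, rfl⟩ := h
  refine ⟨by omega, by omega, hi', T, hT.trans (Ico_subset_Ico_left m.le_succ), rfl, ?_⟩
  rw [packingTerm, pairTerm, if_neg hi.not_gt, Nat.add_sub_cancel, if_pos hi', mul_assoc]

theorem ScanData.insert (h : ScanData M n k v (m + 1) (j + 1) i mask p)
    (hi : numPairs m (j + 1) ≤ i) (hi' : numPairs m j ≤ i - numPairs m (j + 1)) :
    ScanData M n k v m j (i - numPairs m (j + 1) - numPairs m j) (mask + 2 ^ m) p := by
  obtain ⟨hm, hj, hlt, T, hT, rfl, rfl⟩ := h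
  have hmT : m ∉ T := fun hmT => absurd (mem_Ico.mp (hT hmT)).1 (by omega)
  rw [numPairs_succ_succ] at hlt
  refine ⟨by omega, by omega, by omega, Insert.insert m T, ?_, ?_, ?_⟩
  · exact insert_subset (mem_Ico.mpr ⟨le_rfl, hm⟩) (hT.trans (Ico_subset_Ico_left m.le_succ))
  · rw [sum_insert hmT, add_comm]
  · rw [packingTerm, pairTerm, if_neg hi.not_gt, Nat.add_sub_cancel, if_neg hi'.not_gt]

end Scan

section Bounds

open Finset

variable {n k : ℕ}

/-- A bound on the factors of the terms of the sum over pairs. -/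
def factorBound (n k : ℕ) : ℕ := kroneckerBase n ^ (k + 1) * (n + 1)

/-- A bound on all numbers in the computation. -/
def numberBound (n k : ℕ) : ℕ := 2 ^ (n + k) * (n + 1) * factorBound n k ^ (n + 1)

theorem kroneckerBase_pow_le_factorBound {i : ℕ} (hi : i ≤ k + 1) :
    kroneckerBase n ^ i ≤ factorBound n k :=
  (Nat.pow_le_pow_right (Nat.two_pow_pos _) hi).trans (Nat.le_mul_of_pos_right _ n.succ_pos)

theorem kroneckerBase_mul_le_factorBound : kroneckerBase n * (n + 1) ≤ factorBound n k :=
  Nat.mul_le_mul_right _ (Nat.le_self_pow k.succ_ne_zero _)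

theorem factorBound_pos : 0 < factorBound n k :=
  (one_lt_kroneckerBase_pow n k).le.trans (kroneckerBase_pow_le_factorBound le_rfl)

theorem numPairs_mul_le_numberBound {m j x : ℕ} (hm : m ≤ n) (hj : j ≤ k) (hx : x ≤ n + 1) :
    numPairs m j * x ≤ numberBound n k := by
  have hpairs : numPairs m j ≤ 2 ^ (n + k) :=
    (numPairs_le_two_pow m j).trans (Nat.pow_le_pow_right two_pos (by omega))
  exact (Nat.mul_le_mul hpairs hx).trans (Nat.le_mul_of_pos_right _ (Nat.pow_pos factorBound_pos))

theorem le_numberBound_of_le_factorBound {x : ℕ} (hx : x ≤ factorBound n k) :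
    x ≤ numberBound n k :=
  hx.trans ((Nat.le_self_pow n.succ_ne_zero _).trans
    (Nat.le_mul_of_pos_left _ (by positivity)))

theorem degreeWeight_le_factorBound {M : ℕ → ℕ} (hM : ∀ a, M a ≤ 1) (j : ℕ) {T : Finset ℕ}
    (hT : T ⊆ range n) : degreeWeight M n (kroneckerBase n) j T ≤ factorBound n k := by
  have hdeg : ∑ i ∈ T, M (j * n + i) ≤ n :=
    (sum_le_card_nsmul _ _ 1 fun i _ => hM _).trans (by simpa using card_le_card hT)
  have hpos : 0 < kroneckerBase n := Nat.two_pow_pos _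
  refine le_trans ?_ kroneckerBase_mul_le_factorBound
  rw [degreeWeight]
  nlinarith

theorem packingTerm_le {M : ℕ → ℕ} (hM : ∀ a, M a ≤ 1) (i : ℕ) :
    packingTerm M n k n k i ∅ ≤ factorBound n k ^ n :=
  pairTerm_le (fun j _ hT => degreeWeight_le_factorBound hM j hT)
    ((Nat.sub_le _ _).trans (kroneckerBase_pow_le_factorBound le_rfl)) factorBound_pos le_rfl _ _
    (empty_subset _)

theorem sum_packingTerm_le_numberBound {M : ℕ → ℕ} (hM : ∀ a, M a ≤ 1) :
    ∑ i ∈ range (numPairs n k), packingTerm M n k n k i ∅ ≤ numberBound n k := by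
  calc ∑ i ∈ range (numPairs n k), packingTerm M n k n k i ∅
    _ ≤ numPairs n k * factorBound n k ^ n :=
        (sum_le_card_nsmul _ _ _ fun i _ => packingTerm_le hM i).trans_eq
          (by rw [card_range, smul_eq_mul])
    _ ≤ 2 ^ (n + k) * (n + 1) * factorBound n k ^ (n + 1) :=
        Nat.mul_le_mul ((numPairs_le_two_pow n k).trans (Nat.le_mul_of_pos_right _ n.succ_pos))
          (Nat.pow_le_pow_right factorBound_pos n.le_succ)

theorem index_le_numberBound : n * n + n ≤ numberBound n k := by
  have hbase : n * n + 1 < kroneckerBase n := Nat.lt_two_pow_self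
  refine le_numberBound_of_le_factorBound (le_trans ?_ kroneckerBase_mul_le_factorBound)
  nlinarith

theorem right_le_numberBound : k ≤ numberBound n k :=
  le_numberBound_of_le_factorBound <|
    (Nat.lt_pow_self (Nat.one_lt_two_pow (n * n).succ_ne_zero)).le.trans
      (kroneckerBase_pow_le_factorBound k.le_succ)

theorem two_pow_le_numberBound : 2 ^ n ≤ numberBound n k := by
  refine le_numberBound_of_le_factorBound
    (le_trans ?_ (kroneckerBase_pow_le_factorBound (i := 1) (by omega)))
  rw [pow_one, kroneckerBase]
  exact Nat.pow_le_pow_right two_pos (by nlinarith)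

theorem kroneckerBase_le_numberBound : kroneckerBase n ≤ numberBound n k :=
  le_numberBound_of_le_factorBound <|
    (Nat.le_mul_of_pos_right _ n.succ_pos).trans kroneckerBase_mul_le_factorBound

end Bounds

/-! ### The program -/

namespace RAM

section Program

/-! The registers are numbered so that each program only writes from some register on: a loop
therefore leaves everything below its threshold alone. Registers up to `rTotal` hold parameters,
those from `rLeft` on belong to a single scan, and those from `rTmp` on are scratch registers.
Since the machine has no instruction to copy a register, division by `rOne` is used for that. -/

def rN : ℕ := 0
def rK : ℕ := 1
def rOne : ℕ := 2
def rTwo : ℕ := 3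
def rTop : ℕ := 4
def rBase : ℕ := 5
def rBasePow : ℕ := 6
def rModulus : ℕ := 7
def rNeg : ℕ := 8
def rTotal : ℕ := 9
def rAcc : ℕ := 10
def rCnt : ℕ := 11
def rLeft : ℕ := 12
def rNeed : ℕ := 13
def rRank : ℕ := 14
def rBit : ℕ := 15
def rMask : ℕ := 16
def rProd : ℕ := 17
def rBlock : ℕ := 18
def rOut : ℕ := 19
def rTmp : ℕ := 20
def rBits : ℕ := 21
def rAddr : ℕ := 22
def rDeg : ℕ := 23
def rCell : ℕ := 24
def rTodo : ℕ := 25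
def numRegs : ℕ := 26

/-- `reg r := reg b ^ reg rCnt`, given that `rOne` has been set up. -/
def powProg (r b : ℕ) : Prog :=
  .seq (.block [.const r 1]) <|
  .loop rCnt (.block [.arith .mul r r b, .arith .sub rCnt rCnt rOne])

/-- `reg rTotal := numPairs (reg rN) (reg rK)`, by the recursion for consecutive binomial
coefficients. -/
def numPairsProg : Prog :=
  .seq (.block [.const rTotal 1, .const rAcc 0, .arith .div rCnt rK rOne]) <|
  .loop rCnt (.block [.arith .sub rTmp rN rAcc, .arith .mul rTotal rTotal rTmp,
    .arith .add rAcc rAcc rOne, .arith .div rTotal rTotal rAcc, .arith .mul rTotal rTotal rTwo,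
    .arith .sub rCnt rCnt rOne])

/-- Sets up the constants and the powers among the parameters. -/
def powersProg : Prog :=
  .seq (.block [.const rOne 1, .const rTwo 2, .arith .div rCnt rN rOne]) <|
  .seq (powProg rTop rTwo) <|
  .seq (.block [.arith .mul rCnt rN rN, .arith .add rCnt rCnt rOne]) <|
  .seq (powProg rBase rTwo) <|
  .seq (.block [.arith .div rCnt rK rOne]) (powProg rBasePow rBase)

/-- Sets up all parameters, and starts the summation over the pairs. -/
def setup : Prog :=
  .seq powersProg <|
  .seq (.block [.arith .mul rModulus rBasePow rBase, .arith .sub rNeg rModulus rOne]) <|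
  .seq numPairsProg (.block [.const rAcc 0, .arith .div rCnt rTotal rOne])

/-- Adds the entries of the matrix row at `rAddr` that belong to the set with mask `rBits` to
`rDeg`. -/
def degreeLoop : Prog :=
  .loop rTodo (.block [.arith .div rTmp rBits rTwo, .arith .mul rCell rTmp rTwo,
    .arith .sub rBits rBits rCell, .load rCell rAddr, .arith .mul rCell rCell rBits,
    .arith .add rDeg rDeg rCell, .arith .div rBits rTmp rOne, .arith .add rAddr rAddr rOne,
    .arith .sub rTodo rTodo rOne])

/-- The next vertex lies outside `A`: multiply `rProd` by its `degreeWeight`. -/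
def scanOut : Prog :=
  .seq (.block [.arith .div rBlock rOut rOne, .arith .div rBits rMask rOne,
    .arith .mul rAddr rLeft rN, .const rDeg 0, .arith .div rTodo rN rOne]) <|
  .seq degreeLoop (.block [.arith .mul rDeg rDeg rBase, .arith .add rDeg rDeg rOne,
    .arith .mul rProd rProd rDeg])

/-- The next vertex lies in `A`: multiply `rProd` by the modular `-1` in `rNeg`, or add the vertex
to `T`. -/
def scanIn : Prog :=
  .seq (.block [.arith .sub rRank rRank rOut, .arith .sub rBlock rBlock rOut,
    .arith .div rBlock rBlock rTwo, .arith .sub rNeed rNeed rOne,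
    .arith .sub rTmp rBlock rRank]) <|
  .ite rTmp (.block [.arith .mul rProd rProd rNeg])
    (.block [.arith .sub rRank rRank rBlock, .arith .add rMask rMask rBit])

/-- Unranks the pair number `rRank` from the top vertex down, following the order of `pairTerm`, and
multiplies the factors of its term into `rProd`. At the head of the loop `rBlock` holds the number
of pairs that remain possible, so that the size `rOut` of the first block takes only one
multiplication and one division. -/
def scanLoop : Prog :=
  .loop rLeft <| .seq
    (.block [.arith .sub rTmp rLeft rNeed, .arith .mul rOut rBlock rTmp,
      .arith .div rOut rOut rLeft, .arith .sub rLeft rLeft rOne, .arith .div rBit rBit rTwo,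
      .arith .sub rTmp rOut rRank])
    (.ite rTmp scanOut scanIn)

/-- Adds the term of the pair number `rCnt - 1` to `rAcc`. -/
def sumStep : Prog :=
  .seq (.block [.arith .sub rCnt rCnt rOne, .arith .div rLeft rN rOne, .arith .div rNeed rK rOne,
    .arith .div rRank rCnt rOne, .arith .div rBlock rTotal rOne, .arith .div rBit rTop rOne,
    .const rMask 0, .const rProd 1]) <|
  .seq scanLoop (.block [.arith .add rAcc rAcc rProd])

/-- Replaces `n` and `k` in the registers `0` and `1` by the number of `k`-packings in
register `0`. -/
def countPackings : Prog :=
  .seq setup <| .seq (.loop rCnt sumStep) <|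
  .block [.arith .div rOut rAcc rModulus, .arith .mul rOut rOut rModulus,
    .arith .sub rAcc rAcc rOut, .arith .div rN rAcc rBasePow]

end Program

section Correctness

variable {M : ℕ →₀ ℕ} {n k : ℕ} {s : State}

/-- The contents of the parameter registers, which do not change after the setup. -/
def param (n k r : ℕ) : ℕ :=
  [n, k, 1, 2, 2 ^ n, kroneckerBase n, kroneckerBase n ^ k, kroneckerBase n ^ (k + 1),
    kroneckerBase n ^ (k + 1) - 1, numPairs n k].getD r 0

/-- The parameter registers below `b` have been set up. -/
def Loaded (n k b : ℕ) (s : State) : Prop := ∀ r < b, s.reg r = param n k r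

theorem Loaded.agree {b c : ℕ} {s' : State} (h : Loaded n k b s) (h' : Agree c s s')
    (hbc : b ≤ c) : Loaded n k b s' := fun r hr =>
  (h' r (hr.trans_le hbc)).trans (h r hr)

theorem Loaded.succ {b : ℕ} (h : Loaded n k b s) (hb : s.reg b = param n k b) :
    Loaded n k (b + 1) s := fun r hr => by
  rcases (Nat.lt_succ_iff_lt_or_eq.mp hr) with hr | rfl
  exacts [h r hr, hb]

theorem Loaded.wp_block {L b : ℕ} {is : List Instr} {Q : State → Prop} (h : Loaded n k b s)
    (his : (Prog.block is).WritesFrom b)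
    (hblock : Bounded M numRegs L s → BlockSafe numRegs L is s ∧ Q (execBlock is s)) :
    Wp M numRegs L (.block is) s (is.length + 1) (fun s' => Loaded n k b s' ∧ Q s') :=
  ((Wp.block hblock).frame his).mono le_rfl fun _ h' => ⟨h.agree h'.1 le_rfl, h'.2⟩

theorem wp_powProg {L r b e : ℕ} (hbr : b < r) (hr : rOne < r) (hr' : r < rCnt)
    (h : Loaded n k r s) (hcnt : s.reg rCnt = e) (hparam : param n k r = param n k b ^ e)
    (hpos : 0 < param n k b) (hL : param n k r ≤ L) :
    Wp M numRegs L (powProg r b) s (e * 4 + 3) (Loaded n k (r + 1)) := by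
  have hR : r < numRegs := hr'.trans (by decide)
  have hL1 : 1 ≤ L := (Nat.pow_pos hpos).trans_le (hparam ▸ hL)
  refine (Wp.block_forLoop (b := r) (m := e) (N := 3)
    (I := fun c s => s.reg rCnt = c ∧ s.reg r * param n k b ^ c = param n k r)
    (by simp [Prog.block, Prog.WritesFrom, hr'.le]) (fun _ _ h => h.1) (fun _ => ?_) ?_).mono
    (by rw [List.length_singleton]; omega)
    fun s' ⟨hagree, _, hpow⟩ => (h.agree hagree le_rfl).succ (by simpa using hpow)
  · simp only [BlockSafe, execBlock, Instr.Safe, Instr.exec, Finsupp.update_apply, ↓reduceIte,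
      hr'.ne', hR, hL1, hcnt, one_mul, hparam, and_self]
  · rintro c s' hagree ⟨hc, hpow⟩
    have hloaded := h.agree hagree le_rfl
    have hone : s'.reg rOne = 1 := hloaded rOne hr
    rw [pow_succ', ← mul_assoc] at hpow
    have hmul : s'.reg r * param n k b ≤ L :=
      (Nat.le_mul_of_pos_right _ (Nat.pow_pos hpos)).trans (hpow.le.trans hL)
    refine Wp.block fun hs' => ?_
    have hcL := hs'.reg_le rCnt
    simp +decide only [BlockSafe, execBlock, Instr.Safe, Instr.exec, Op.eval,
      Finsupp.update_apply, ↓reduceIte, hone, hloaded b hbr, hr'.ne, hr'.ne', hr.ne, hR, hc, hpow,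
      hmul, true_and, and_true]
    omega

theorem wp_numPairsProg (h : Loaded n k 9 s) :
    Wp M numRegs (numberBound n k) numPairsProg s (k * 8 + 5) (Loaded n k 10) := by
  have hkL : k ≤ numberBound n k := right_le_numberBound
  refine (Wp.block_forLoop (b := 9) (m := k) (N := 7)
    (I := fun c s => s.reg rCnt = c ∧ s.reg rAcc + c = k ∧ s.reg rTotal = numPairs n (s.reg rAcc))
    (by simp +decide [Prog.block, Prog.WritesFrom]) (fun _ _ h => h.1) (fun _ => ?_) ?_).mono
    (by simp only [List.length_cons, List.length_nil]; omega)
    fun s' ⟨hagree, _, hacc, htotal⟩ =>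
      (h.agree hagree le_rfl).succ (htotal.trans (congrArg _ hacc))
  · have hk : s.reg rK = k := h rK (by decide)
    have hone : s.reg rOne = 1 := h rOne (by decide)
    have hpos : 1 ≤ numberBound n k := Nat.one_le_two_pow.trans two_pow_le_numberBound
    simp +decide only [BlockSafe, execBlock, Instr.Safe, Instr.exec, Op.eval,
      Finsupp.update_apply, ↓reduceIte, hk, hone, Nat.div_one, hkL, hpos, zero_le, zero_add,
      numPairs_zero_right, and_self]
  · rintro c s' hagree ⟨hc, hacc, htotal⟩
    have hloaded := h.agree hagree le_rfl
    have hn : s'.reg rN = n := hloaded rN (by decide)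
    have hone : s'.reg rOne = 1 := hloaded rOne (by decide)
    have htwo : s'.reg rTwo = 2 := hloaded rTwo (by decide)
    refine Wp.block fun hs' => ?_
    have hcL := hs'.reg_le rCnt
    have hnL := hn ▸ hs'.reg_le rN
    have hmul : numPairs n (s'.reg rAcc) * (n - s'.reg rAcc) ≤ numberBound n k :=
      numPairs_mul_le_numberBound le_rfl (by omega) (by omega)
    have hdivL := Nat.div_le_self (numPairs n (s'.reg rAcc) * (n - s'.reg rAcc)) (s'.reg rAcc + 1)
    have hnext : numPairs n (s'.reg rAcc + 1) ≤ numberBound n k := by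
      simpa using numPairs_mul_le_numberBound (x := 1) (le_refl n) (by omega) (by omega)
    have hdiv := numPairs_mul_div_succ_right n (s'.reg rAcc)
    simp +decide only [BlockSafe, execBlock, Instr.Safe, Instr.exec, Op.eval,
      Finsupp.update_apply, ↓reduceIte, hn, hone, htwo, hc, htotal, hdiv, true_and, and_true]
    omega

theorem wp_powersProg (h : Loaded n k 2 s) :
    Wp M numRegs (numberBound n k) powersProg s (4 * (n * n) + 4 * n + 4 * k + 22)
      (Loaded n k 7) := by
  have hnL : n * n + n ≤ numberBound n k := index_le_numberBound
  have hkL : k ≤ numberBound n k := right_le_numberBound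
  have hbaseL : kroneckerBase n ≤ numberBound n k := kroneckerBase_le_numberBound
  have hpowL : kroneckerBase n ^ k ≤ numberBound n k :=
    le_numberBound_of_le_factorBound (kroneckerBase_pow_le_factorBound k.le_succ)
  have hnn : n * n + 1 < kroneckerBase n := Nat.lt_two_pow_self
  refine ((h.wp_block (by simp +decide [Prog.block, Prog.WritesFrom])
    (Q := fun s => s.reg rOne = 1 ∧ s.reg rTwo = 2 ∧ s.reg rCnt = n) fun _ => ?_).seq
    fun _ ⟨h, hone, htwo, hcnt⟩ =>
    (wp_powProg (b := rTwo) (by decide) (by decide) (by decide) ((h.succ hone).succ htwo) hcnt rfl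
      two_pos two_pow_le_numberBound).seq fun s h =>
    (h.wp_block (by simp +decide [Prog.block, Prog.WritesFrom])
      (Q := fun s => s.reg rCnt = n * n + 1) fun _ => ?_).seq fun _ ⟨h, hcnt⟩ =>
    (wp_powProg (b := rTwo) (by decide) (by decide) (by decide) h hcnt rfl two_pos hbaseL).seq
      fun s h =>
    (h.wp_block (by simp +decide [Prog.block, Prog.WritesFrom])
      (Q := fun s => s.reg rCnt = k) fun _ => ?_).seq fun _ ⟨h, hcnt⟩ =>
    wp_powProg (b := rBase) (by decide) (by decide) (by decide) h hcnt rfl (Nat.two_pow_pos _)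
      hpowL).mono (by simp only [List.length_cons, List.length_nil]; omega) fun _ => id
  · have hn : s.reg rN = n := h rN (by decide)
    simp +decide only [BlockSafe, execBlock, Instr.Safe, Instr.exec, Op.eval,
      Finsupp.update_apply, ↓reduceIte, hn, Nat.div_one, true_and, and_true]
    omega
  · have hn : s.reg rN = n := h rN (by decide)
    have hone : s.reg rOne = 1 := h rOne (by decide)
    simp +decide only [BlockSafe, execBlock, Instr.Safe, Instr.exec, Op.eval,
      Finsupp.update_apply, ↓reduceIte, hn, hone, true_and, and_true]
    omega
  · have hk : s.reg rK = k := h rK (by decide)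
    have hone : s.reg rOne = 1 := h rOne (by decide)
    simp +decide only [BlockSafe, execBlock, Instr.Safe, Instr.exec, Op.eval,
      Finsupp.update_apply, ↓reduceIte, hk, hone, Nat.div_one, hkL, true_and]

theorem wp_setup (h : Loaded n k 2 s) :
    Wp M numRegs (numberBound n k) setup s (4 * (n * n) + 4 * n + 12 * k + 33)
      (fun s' => Loaded n k 10 s' ∧ s'.reg rAcc = 0 ∧ s'.reg rCnt = numPairs n k) := by
  have hmodL : kroneckerBase n ^ (k + 1) ≤ numberBound n k :=
    le_numberBound_of_le_factorBound (kroneckerBase_pow_le_factorBound le_rfl)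
  have hpairs : numPairs n k ≤ numberBound n k := by
    simpa using numPairs_mul_le_numberBound (x := 1) (le_refl n) (le_refl k) (by omega)
  refine ((wp_powersProg h).seq fun s h =>
    (h.wp_block (by simp +decide [Prog.block, Prog.WritesFrom])
      (Q := fun s => s.reg rModulus = kroneckerBase n ^ (k + 1) ∧
        s.reg rNeg = kroneckerBase n ^ (k + 1) - 1) fun _ => ?_).seq fun _ ⟨h, hmod, hneg⟩ =>
    (wp_numPairsProg ((h.succ hmod).succ hneg)).seq fun s h =>
    h.wp_block (by simp +decide [Prog.block, Prog.WritesFrom]) fun _ => ?_).mono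
      (by simp only [List.length_cons, List.length_nil]; omega) fun _ => id
  · have hone : s.reg rOne = 1 := h rOne (by decide)
    have hbase : s.reg rBase = kroneckerBase n := h rBase (by decide)
    have hpow : s.reg rBasePow = kroneckerBase n ^ k := h rBasePow (by decide)
    simp +decide only [BlockSafe, execBlock, Instr.Safe, Instr.exec, Op.eval,
      Finsupp.update_apply, ↓reduceIte, hone, hbase, hpow, ← pow_succ, hmodL, true_and,
      and_true]
    exact (Nat.sub_le _ _).trans hmodL
  · have hone : s.reg rOne = 1 := h rOne (by decide)
    have htotal : s.reg rTotal = numPairs n k := h rTotal (by decide)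
    simp +decide only [BlockSafe, execBlock, Instr.Safe, Instr.exec, Op.eval,
      Finsupp.update_apply, ↓reduceIte, hone, htotal, Nat.div_one, hpairs, zero_le, true_and]

theorem wp_degreeLoop {L B A D : ℕ} (h : Loaded n k 10 s) (hbits : s.reg rBits = B)
    (haddr : s.reg rAddr = A) (hdeg : s.reg rDeg = 0) (htodo : s.reg rTodo = n) (hM : ∀ a, M a ≤ 1)
    (hAL : A + n ≤ L) (hD : ∑ l ∈ Finset.range n, B / 2 ^ l % 2 * M (A + l) = D) (hDL : D ≤ L) :
    Wp M numRegs L degreeLoop s (n * 11 + 1) (fun s' => Agree 20 s s' ∧ s'.reg rDeg = D) := by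
  refine (Wp.forLoop (b := 20)
    (I := fun c s => s.reg rTodo = c ∧ s.reg rAddr + c = A + n ∧
      s.reg rDeg + ∑ l ∈ Finset.range c, s.reg rBits / 2 ^ l % 2 * M (s.reg rAddr + l) = D)
    (N := 10) (by simp +decide [Prog.block, Prog.WritesFrom]) (fun _ _ h => h.1) ?_
    ⟨htodo, by omega, by rw [hbits, haddr, hdeg, hD, zero_add]⟩).mono le_rfl
    (fun s' h => ⟨h.1, by simpa using h.2.2.2⟩)
  rintro c s' hagree ⟨hc, hA, hsum⟩
  have hone : s'.reg rOne = 1 := (hagree rOne (by decide)).trans (h rOne (by decide))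
  have htwo : s'.reg rTwo = 2 := (hagree rTwo (by decide)).trans (h rTwo (by decide))
  refine Wp.block fun hs' => ?_
  have hbits := hs'.reg_le rBits
  have hbit : s'.reg rBits - s'.reg rBits / 2 * 2 = s'.reg rBits % 2 := by omega
  have hcell : M (s'.reg rAddr) * (s'.reg rBits % 2) ≤ D ∧ s'.reg rDeg +
      M (s'.reg rAddr) * (s'.reg rBits % 2) + ∑ l ∈ Finset.range c,
        s'.reg rBits / 2 / 2 ^ l % 2 * M (s'.reg rAddr + 1 + l) = D := by
    rw [Finset.sum_range_succ', pow_zero, Nat.div_one, add_zero, mul_comm (_ % 2)] at hsum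
    simp_rw [Nat.div_div_eq_div_mul, ← pow_succ', add_assoc, add_comm 1]
    omega
  have hMA := hM (s'.reg rAddr)
  simp +decide only [BlockSafe, execBlock, Instr.Safe, Instr.exec, Op.eval, Finsupp.update_apply,
    ↓reduceIte, hone, htwo, hc, hs'.mem_eq, Nat.div_one, true_and, and_true, hbit, hcell.2]
  omega

/-- A state between two iterations of the scan. -/
def ScanInv (M : ℕ → ℕ) (n k v m : ℕ) (s : State) : Prop :=
  s.reg rLeft = m ∧ s.reg rBit = 2 ^ m ∧ s.reg rBlock = numPairs m (s.reg rNeed) ∧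
    ScanData M n k v m (s.reg rNeed) (s.reg rRank) (s.reg rMask) (s.reg rProd)

/-- A state in which the scan is about to decide whether vertex `m` belongs to the pair. -/
def ScanTest (M : ℕ → ℕ) (n k v m : ℕ) (s : State) : Prop :=
  s.reg rLeft = m ∧ s.reg rBit = 2 ^ m ∧ s.reg rBlock = numPairs (m + 1) (s.reg rNeed) ∧
    s.reg rOut = numPairs m (s.reg rNeed) ∧ s.reg rTmp = s.reg rOut - s.reg rRank ∧
    ScanData M n k v (m + 1) (s.reg rNeed) (s.reg rRank) (s.reg rMask) (s.reg rProd)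

variable {v m : ℕ}

theorem wp_scanOut (hM : ∀ a, M a ≤ 1) (hv : v ≤ numberBound n k) (h : Loaded n k 10 s)
    (ht : ScanTest M n k v m s) (hout : s.reg rTmp ≠ 0) :
    Wp M numRegs (numberBound n k) scanOut s (n * 11 + 11) (ScanInv M n k v m) := by
  obtain ⟨hleft, hbit, -, hblock, htmp, hdata⟩ := ht
  have hn : s.reg rN = n := h rN (by decide)
  have hone : s.reg rOne = 1 := h rOne (by decide)
  have hbase : s.reg rBase = kroneckerBase n := h rBase (by decide)
  have hnL : n * n + n ≤ numberBound n k := index_le_numberBound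
  have hbaseL : kroneckerBase n * (n + 1) ≤ numberBound n k :=
    le_numberBound_of_le_factorBound kroneckerBase_mul_le_factorBound
  have haddr : m * n + n ≤ n * n := by nlinarith [hdata.1]
  have hdata' := hdata.weight (by omega)
  set D := ∑ l ∈ Finset.range n, s.reg rMask / 2 ^ l % 2 * M (m * n + l) with hD
  have hDn : D ≤ n := by
    simpa using Finset.sum_le_card_nsmul (Finset.range n) _ 1 fun l _ =>
      Nat.mul_le_mul (Nat.le_of_lt_succ (Nat.mod_lt (s.reg rMask / 2 ^ l) two_pos)) (hM (m * n + l))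
  refine (((Wp.block (Q := fun s' => s'.reg rBlock = numPairs m (s.reg rNeed) ∧
      s'.reg rBits = s.reg rMask ∧ s'.reg rAddr = m * n ∧ s'.reg rDeg = 0 ∧ s'.reg rTodo = n)
    fun hs => ?_).frame (b := 18) (by simp +decide [Prog.block, Prog.WritesFrom])).seq
    fun s₁ ⟨h₁, hblock₁, hbits, haddr, hdeg, htodo⟩ =>
    (wp_degreeLoop (h.agree h₁ (by decide)) hbits haddr hdeg htodo hM (by omega) hD.symm
      (by omega)).seq fun s₂ ⟨h₂, hdeg⟩ => Wp.block fun hs => ?_).mono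
      (by simp only [List.length_cons, List.length_nil]; omega) fun _ => id
  · have hmaskL := hs.reg_le rMask
    have hblockL := hs.reg_le rOut
    rw [hblock] at hblockL
    simp +decide only [BlockSafe, execBlock, Instr.Safe, Instr.exec, Op.eval,
      Finsupp.update_apply, ↓reduceIte, hn, hone, hleft, hblock, Nat.div_one, true_and, and_true]
    omega
  · have hagree := h₁.trans fun r (hr : r < 18) => h₂ r (by omega)
    have hblock₂ : s₂.reg rBlock = numPairs m (s.reg rNeed) := (h₂ _ (by decide)).trans hblock₁
    have hprod := hdata'.prod_le
    have hfactor : 1 + kroneckerBase n * D ≤ numberBound n k := by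
      have hpos : 0 < kroneckerBase n := Nat.two_pow_pos _
      nlinarith
    rw [add_comm 1, mul_comm (kroneckerBase n)] at hdata' hprod hfactor
    simp +decide only [BlockSafe, execBlock, Instr.Safe, Instr.exec, Op.eval, ScanInv,
      Finsupp.update_apply, ↓reduceIte, hagree rOne (by decide), hagree rBase (by decide),
      hagree rLeft (by decide), hagree rBit (by decide), hagree rNeed (by decide),
      hagree rRank (by decide), hagree rMask (by decide), hagree rProd (by decide), hone, hbase,
      hleft, hbit, hblock₂, hdeg, hdata',
      true_and, and_true]
    omega

theorem wp_scanIn (hv : v ≤ numberBound n k) (h : Loaded n k 10 s)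
    (ht : ScanTest M n k v m s) (hin : s.reg rTmp = 0) :
    Wp M numRegs (numberBound n k) scanIn s 10 (ScanInv M n k v m) := by
  obtain ⟨hleft, hbit, hblock, hout, htmp, hdata⟩ := ht
  have hone : s.reg rOne = 1 := h rOne (by decide)
  have htwo : s.reg rTwo = 2 := h rTwo (by decide)
  have hneg : s.reg rNeg = kroneckerBase n ^ (k + 1) - 1 := h rNeg (by decide)
  have hle : numPairs m (s.reg rNeed) ≤ s.reg rRank := by omega
  obtain ⟨j, hj⟩ := hdata.exists_eq_succ hle
  rw [hj] at hblock hout hdata hle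
  have hhalf : (numPairs (m + 1) (j + 1) - numPairs m (j + 1)) / 2 = numPairs m j := by
    rw [numPairs_succ_succ]
    omega
  refine ((Wp.block (Q := fun s' => s'.reg rRank = s.reg rRank - numPairs m (j + 1) ∧
      s'.reg rBlock = numPairs m j ∧ s'.reg rNeed = j ∧ s'.reg rTmp = s'.reg rBlock - s'.reg rRank ∧
      s'.reg rNeg = s.reg rNeg ∧
      s'.reg rLeft = m ∧ s'.reg rBit = 2 ^ m ∧ s'.reg rMask = s.reg rMask ∧
      s'.reg rProd = s.reg rProd) fun hs => ?_).seq
    fun s' ⟨hrank, hblock', hneed, _, hneg', hleft, hbit, hmask, hprod⟩ => Wp.ite (N := 3)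
      (fun htest => (Wp.block fun _ => ?_).mono (by decide) fun _ => id)
      (fun htest => Wp.block fun hs => ?_)).mono
      (by simp only [List.length_cons, List.length_nil]; omega) fun _ => id
  · have hrankL := hs.reg_le rRank
    have hblockL := hs.reg_le rBlock
    have hneedL := hs.reg_le rNeed
    simp +decide only [BlockSafe, execBlock, Instr.Safe, Instr.exec, Op.eval,
      Finsupp.update_apply, ↓reduceIte, hone, htwo, hout, hleft, hbit, hj, hblock, hhalf,
      Nat.add_sub_cancel, true_and, and_true]
    omega
  · have hdata' := hdata.neg hle (by omega)
    have hprodL := hdata'.prod_le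
    simp +decide only [BlockSafe, execBlock, Instr.Safe, Instr.exec, Op.eval, ScanInv,
      Finsupp.update_apply, ↓reduceIte, hrank, hblock', hneed, hneg', hneg, hleft, hbit, hmask,
      hprod, hdata', true_and, and_true]
    omega
  · have hdata' := hdata.insert hle (by omega)
    have hmaskL := hdata'.mask_lt.le.trans (two_pow_le_numberBound (k := k))
    have hrankL := hs.reg_le rRank
    simp +decide only [BlockSafe, execBlock, Instr.Safe, Instr.exec, Op.eval, ScanInv,
      Finsupp.update_apply, ↓reduceIte, hrank, hblock', hneed, hleft, hbit, hmask, hprod, hdata',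
      hmaskL, true_and, and_true]
    omega

theorem wp_scanLoop (hM : ∀ a, M a ≤ 1) (hv : v ≤ numberBound n k) (h : Loaded n k 10 s)
    (hi : ScanInv M n k v n s) :
    Wp M numRegs (numberBound n k) scanLoop s (n * (n * 11 + 20) + 1)
      (fun s' => Agree 12 s s' ∧ s'.reg rProd = v) := by
  refine (Wp.forLoop (b := 12) (I := ScanInv M n k v) (N := n * 11 + 19)
    (by simp +decide [Prog.block, Prog.WritesFrom, scanOut, scanIn, degreeLoop])
    (fun _ _ h => h.1) (fun m s' hagree ⟨hleft, hbit, hblock, hdata⟩ => ?_) hi).mono le_rfl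
    fun s' h => ⟨h.1, h.2.2.2.2.prod_eq⟩
  have hloaded := h.agree hagree (by decide)
  refine ((hloaded.wp_block (Q := ScanTest M n k v m)
    (by simp +decide [Prog.block, Prog.WritesFrom]) fun hs => ?_).seq fun _ ⟨h₁, ht⟩ =>
    Wp.ite (wp_scanOut hM hv h₁ ht) fun hin =>
    (wp_scanIn hv h₁ ht hin).mono (by omega) fun _ => id).mono
    (by simp only [List.length_cons, List.length_nil]; omega) fun _ => id
  have hone : s'.reg rOne = 1 := hloaded rOne (by decide)
  have htwo : s'.reg rTwo = 2 := hloaded rTwo (by decide)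
  have hout := numPairs_mul_div m (s'.reg rNeed)
  have hleftL := hs.reg_le rLeft
  have hbitL := hs.reg_le rBit
  have hmul : numPairs (m + 1) (s'.reg rNeed) * (m + 1 - s'.reg rNeed) ≤ numberBound n k :=
    numPairs_mul_le_numberBound hdata.1 hdata.2.1 (by have := hdata.1; omega)
  have houtL : numPairs m (s'.reg rNeed) ≤ numberBound n k := by
    simpa using numPairs_mul_le_numberBound (x := 1) (m.le_succ.trans hdata.1) hdata.2.1 (by omega)
  have hhalf : 2 ^ (m + 1) / 2 = 2 ^ m := by rw [pow_succ, Nat.mul_div_cancel _ two_pos]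
  rw [hleft] at hleftL
  rw [hbit, pow_succ] at hbitL
  simp +decide only [BlockSafe, execBlock, Instr.Safe, Instr.exec, Op.eval, ScanTest,
    Finsupp.update_apply, ↓reduceIte, hone, htwo, hleft, hbit, hblock, hout, hhalf, hmul, houtL,
    hdata, Nat.add_sub_cancel, true_and, and_true]
  omega

/-- A state between two iterations of the main loop, when `c` terms are still to be added. -/
def SumInv (M : ℕ → ℕ) (n k c : ℕ) (s : State) : Prop :=
  s.reg rCnt = c ∧ c ≤ numPairs n k ∧
    s.reg rAcc + ∑ i ∈ Finset.range c, packingTerm M n k n k i ∅ =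
      ∑ i ∈ Finset.range (numPairs n k), packingTerm M n k n k i ∅

theorem wp_sumStep (hM : ∀ a, M a ≤ 1) (h : Loaded n k 10 s) {c : ℕ}
    (hc : SumInv M n k (c + 1) s) :
    Wp M numRegs (numberBound n k) sumStep s (n * (n * 11 + 20) + 12) (SumInv M n k c) := by
  obtain ⟨hcnt, hle, hsum⟩ := hc
  rw [Finset.sum_range_succ] at hsum
  have hsumL := sum_packingTerm_le_numberBound (n := n) (k := k) hM
  set v := packingTerm M n k n k c ∅
  refine (((h.wp_block (Q := fun s' => s'.reg rAcc = s.reg rAcc ∧ s'.reg rCnt = c ∧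
    ScanInv M n k v n s') (by simp +decide [Prog.block, Prog.WritesFrom])
    fun hs => ?_).seq fun s₁ ⟨h₁, hacc, hcnt, hi⟩ =>
    (wp_scanLoop hM (by omega) h₁ hi).seq fun s₂ ⟨hagree, hprod⟩ => Wp.block fun _ => ?_).mono
    (by simp only [List.length_cons, List.length_nil]; omega) fun _ => id)
  · have hn : s.reg rN = n := h rN (by decide)
    have hk : s.reg rK = k := h rK (by decide)
    have hone : s.reg rOne = 1 := h rOne (by decide)
    have htop : s.reg rTop = 2 ^ n := h rTop (by decide)
    have htotal : s.reg rTotal = numPairs n k := h rTotal (by decide)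
    have hdata := scanData_init (M := M) (n := n) (k := k) (i := c) (by omega)
    have hregL (r) := hs.reg_le r
    have hnL := hn ▸ hregL rN
    have hkL := hk ▸ hregL rK
    have htopL := htop ▸ hregL rTop
    have htotalL := htotal ▸ hregL rTotal
    have hcntL := hcnt ▸ hregL rCnt
    simp +decide only [BlockSafe, execBlock, Instr.Safe, Instr.exec, Op.eval, ScanInv,
      Finsupp.update_apply, ↓reduceIte, hn, hk, hone, htop, htotal, hcnt, hdata, v,
      Nat.add_sub_cancel, Nat.div_one, true_and, and_true]
    omega
  · simp +decide only [BlockSafe, execBlock, Instr.Safe, Instr.exec, Op.eval, SumInv,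
      Finsupp.update_apply, ↓reduceIte, hagree rAcc (by decide), hagree rCnt (by decide), hacc,
      hcnt, hprod, true_and, and_true]
    omega

theorem wp_countPackings (hM : ∀ a, M a ≤ 1) (h : Loaded n k 2 s) :
    Wp M numRegs (numberBound n k) countPackings s
      (4 * (n * n) + 4 * n + 12 * k + 39 + numPairs n k * (n * (n * 11 + 20) + 13)) fun s' =>
        s'.reg 0 = (∑ i ∈ Finset.range (numPairs n k), packingTerm M n k n k i ∅) %
          kroneckerBase n ^ (k + 1) / kroneckerBase n ^ k := by
  have hsumL := sum_packingTerm_le_numberBound (n := n) (k := k) hM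
  set S := ∑ i ∈ Finset.range (numPairs n k), packingTerm M n k n k i ∅ with hS
  refine ((wp_setup h).seq fun s₁ ⟨h₁, hacc, hcnt⟩ =>
    (Wp.forLoop (b := 10) (I := SumInv M n k) (N := n * (n * 11 + 20) + 12)
      (by simp +decide [Prog.block, Prog.WritesFrom, sumStep, scanLoop, scanOut, scanIn,
        degreeLoop])
      (fun _ _ h => h.1) (fun _ _ hagree => wp_sumStep hM (h₁.agree hagree le_rfl))
      ⟨hcnt, le_rfl, by rw [hacc, zero_add]⟩).seq
    fun s₂ ⟨hagree, _, _, hsum⟩ => Wp.block fun _ => ?_).mono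
    (by simp only [List.length_cons, List.length_nil]; linarith) fun _ => id
  have hmod : s₂.reg rModulus = kroneckerBase n ^ (k + 1) :=
    h₁.agree hagree le_rfl rModulus (by decide)
  have hpow : s₂.reg rBasePow = kroneckerBase n ^ k := h₁.agree hagree le_rfl rBasePow (by decide)
  rw [Finset.sum_range_zero, add_zero, ← hS] at hsum
  have hdiv := Nat.div_mul_le_self S (kroneckerBase n ^ (k + 1))
  have hdiv' := Nat.div_le_self S (kroneckerBase n ^ (k + 1))
  have hres := Nat.div_le_self (S % kroneckerBase n ^ (k + 1)) (kroneckerBase n ^ k)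
  have hmodle := Nat.mod_le S (kroneckerBase n ^ (k + 1))
  have hsub : S - S / kroneckerBase n ^ (k + 1) * kroneckerBase n ^ (k + 1) =
      S % kroneckerBase n ^ (k + 1) := by
    rw [Nat.mod_eq_sub_div_mul]
  simp +decide only [BlockSafe, execBlock, Instr.Safe, Instr.exec, Op.eval,
    Finsupp.update_apply, ↓reduceIte, hmod, hpow, hsum, hsub, true_and, and_true]
  omega

end Correctness

end RAM

/-! ### The polynomial bounds -/

section Polynomial

open Finset

variable (n k : ℕ)

theorem size_numberBound_le : Nat.size (numberBound n k) ≤ 4 * (n + k + 1) ^ 4 := by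
  have hn : n + 1 ≤ 2 ^ n := Nat.lt_two_pow_self
  have hfactor : factorBound n k ≤ 2 ^ ((n * n + 1) * (k + 1) + n) := by
    rw [factorBound, kroneckerBase, ← pow_mul, pow_add]
    exact Nat.mul_le_mul_left _ hn
  have hbound : numberBound n k ≤
      2 ^ (n + k + n + ((n * n + 1) * (k + 1) + n) * (n + 1)) := by
    rw [numberBound, pow_add _ (n + k + n), pow_add _ (n + k), pow_mul]
    exact Nat.mul_le_mul (Nat.mul_le_mul_left _ hn) (Nat.pow_le_pow_left hfactor _)
  refine (Nat.size_le.mpr (hbound.trans_lt (Nat.pow_lt_pow_succ one_lt_two))).trans ?_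
  set x := n + k + 1 with hx
  have hx4 : x ≤ x ^ 4 := Nat.le_self_pow (by decide) x
  have hx24 : x ^ 2 ≤ x ^ 4 := Nat.pow_le_pow_right (by omega) (by decide)
  have hbase : n * n + 1 ≤ x ^ 2 := by nlinarith
  have hexp : ((n * n + 1) * (k + 1) + n) * (n + 1) ≤ (x ^ 2 * x + x) * x := by
    gcongr <;> omega
  have hexp' : (x ^ 2 * x + x) * x = x ^ 4 + x ^ 2 := by ring
  omega

theorem stepTime_numberBound_le : RAM.stepTime (numberBound n k) ≤ 25 * (n + k + 1) ^ 8 := by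
  have hx4 : 0 < (n + k + 1) ^ 4 := by positivity
  have hsize := size_numberBound_le n k
  calc RAM.stepTime (numberBound n k)
    _ ≤ (5 * (n + k + 1) ^ 4) * (5 * (n + k + 1) ^ 4) := by
        rw [RAM.stepTime]
        exact Nat.mul_le_mul (by omega) (by omega)
    _ = 25 * (n + k + 1) ^ 8 := by ring

theorem steps_le : 4 * (n * n) + 4 * n + 12 * k + 39 + numPairs n k * (n * (n * 11 + 20) + 13) ≤
    103 * (n + k + 1) ^ 2 * (2 ^ k * max 1 (n.choose k)) := by
  set N := 2 ^ k * max 1 (n.choose k)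
  have hN : 1 ≤ N := Nat.mul_pos (by positivity) (by omega)
  have hpairs : numPairs n k ≤ N := by
    rw [numPairs, mul_comm]
    exact Nat.mul_le_mul_left _ (le_max_right _ _)
  calc 4 * (n * n) + 4 * n + 12 * k + 39 + numPairs n k * (n * (n * 11 + 20) + 13)
    _ ≤ (59 * (n + k + 1) ^ 2) * N + N * (44 * (n + k + 1) ^ 2) :=
        Nat.add_le_add ((show _ ≤ _ by ring_nf; omega).trans (Nat.le_mul_of_pos_right _ hN))
          (Nat.mul_le_mul hpairs (by ring_nf; omega))
    _ = 103 * (n + k + 1) ^ 2 * N := by ring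

end Polynomial

namespace RAM

variable {n k : ℕ} {F : Finset (Finset (Fin n))}

theorem cellBits_pairMatrix_le (F : Finset (Finset (Fin n))) :
    cellBits (pairMatrix F) ≤ n * n * (n * n + 1) := by
  have hsupport : (pairMatrix F).support ⊆ Finset.range (n * n) := Finsupp.support_onFinset_subset
  refine (Finset.sum_le_card_nsmul _ _ (n * n + 1) fun a ha => ?_).trans
    (Nat.mul_le_mul_right _ (by simpa using Finset.card_le_card hsupport))
  have haddr : Nat.size a ≤ n * n :=
    Nat.size_le.mpr ((Finset.mem_range.mp (hsupport ha)).trans Nat.lt_two_pow_self)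
  have hcell := Nat.size_le_size (pairMatrix_le_one F a)
  rw [Nat.size_one] at hcell
  exact Nat.add_le_add haddr hcell

theorem space_pairMatrix_numberBound_le (k : ℕ) (F : Finset (Finset (Fin n))) :
    space (pairMatrix F) numRegs (numberBound n k) ≤ 1000 * (n + k + 1) ^ 4 := by
  have hsize := size_numberBound_le n k
  have hsq : (n + k + 1) ^ 2 = n * n + 2 * (n * k) + k * k + 2 * n + 2 * k + 1 := by ring
  have hcells : cellBits (pairMatrix F) ≤ (n + k + 1) ^ 4 := by
    refine (cellBits_pairMatrix_le F).trans ?_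
    rw [pow_add _ 2 2]
    exact Nat.mul_le_mul (by omega) (by omega)
  have hpos : 0 < (n + k + 1) ^ 4 := by positivity
  rw [space, numRegs]
  omega

theorem loaded_input : Loaded n k 2 (input n k F) := fun r hr => by
  interval_cases r <;> simp [input, param]

theorem bounded_input : Bounded (pairMatrix F) numRegs (numberBound n k) (input n k F) where
  mem_eq := rfl
  reg_le r := by
    have hn : n * n + n ≤ numberBound n k := index_le_numberBound
    have hk : k ≤ numberBound n k := right_le_numberBound
    rw [input, Finsupp.add_apply, Finsupp.single_apply, Finsupp.single_apply]
    split_ifs <;> omega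
  reg_eq_zero r hr := by
    rw [numRegs] at hr
    rw [input, Finsupp.add_apply, Finsupp.single_apply, Finsupp.single_apply]
    split_ifs <;> omega

theorem sum_packingTerm_mod_div_eq_numPackings (hF : ∀ A ∈ F, A.card = 2) (k : ℕ) :
    (∑ i ∈ Finset.range (numPairs n k), packingTerm (pairMatrix F) n k n k i ∅) %
      kroneckerBase n ^ (k + 1) / kroneckerBase n ^ k = numPackings F k := by
  rw [packingTerm, sum_pairTerm]
  exact pairSum_mod_div_eq_numPackings hF (numPackings_lt hF k)

theorem exists_run_countPackings (k : ℕ) (hF : ∀ A ∈ F, A.card = 2) :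
    ∃ s t b, Run countPackings (input n k F) s t b ∧ s.reg 0 = numPackings F k ∧
      t ≤ 2575 * (n + k + 1) ^ 10 * (2 ^ k * max 1 (n.choose k)) ∧
      b ≤ 1000 * (n + k + 1) ^ 4 := by
  obtain ⟨s, t, b, hrun, ht, hb, -, hs⟩ :=
    wp_countPackings (pairMatrix_le_one F) loaded_input bounded_input
  refine ⟨s, t, b, hrun, hs.trans (sum_packingTerm_mod_div_eq_numPackings hF k), ?_,
    hb.trans (space_pairMatrix_numberBound_le k F)⟩
  calc t
    _ ≤ 103 * (n + k + 1) ^ 2 * (2 ^ k * max 1 (n.choose k)) * (25 * (n + k + 1) ^ 8) :=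
        ht.trans (Nat.mul_le_mul (steps_le n k) (stepTime_numberBound_le n k))
    _ = 2575 * (n + k + 1) ^ 10 * (2 ^ k * max 1 (n.choose k)) := by ring

end RAM

theorem corollary6_general :
    ∃ (P : RAM.Prog) (c : ℕ), ∀ (n k : ℕ) (F : Finset (Finset (Fin n))),
      (∀ A ∈ F, A.card = 2) →
      ∃ (s : RAM.State) (t b : ℕ),
        RAM.Run P (RAM.input n k F) s t b ∧
        s.reg 0 = numPackings F k ∧
        t ≤ c * (n + k + 1) ^ c * (2 ^ k * max 1 (n.choose k)) ∧
        b ≤ c * (n + k + 1) ^ c := by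
  refine ⟨RAM.countPackings, 2575, fun n k F hF => ?_⟩
  obtain ⟨s, t, b, hrun, hs, ht, hb⟩ := RAM.exists_run_countPackings k hF
  refine ⟨s, t, b, hrun, hs, ht.trans ?_, hb.trans ?_⟩ <;> gcongr <;> omega

theorem corollary6 :
    ∃ (P : RAM.Prog) (c : ℕ), ∀ (n k : ℕ) (F : Finset (Finset (Fin n))),
      (∀ A ∈ F, A.card = 2) →
      ∃ (s : RAM.State) (t b : ℕ),
        RAM.Run P (RAM.input n k F) s t b ∧
        s.reg 0 = numPackings F k ∧
        t ≤ c * (n + k + 1) ^ c * (3 ^ k * max 1 (n.choose k)) ∧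
        b ≤ c * (n + k + 1) ^ c := by
  obtain ⟨P, c, h⟩ := corollary6_general
  exact ⟨P, c, fun n k F hF => let ⟨s, t, b, hrun, hs, ht, hb⟩ := h n k F hF
    ⟨s, t, b, hrun, hs, ht.trans (by gcongr; decide), hb⟩⟩
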